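/- \textbf{Definitions.} Let $\overline{\mathbb Q}_{\ge 0}=\mathbb Q_{\ge 0}\cup\{\infty\}$ with $c+\infty=\infty+c=\infty$, $c\cdot\infty=\infty\cdot c=\infty$ for $c\neq 0$, and $0\cdot\infty=\infty\cdot 0=0$. A signature $\tau$ is a set of function symbols $f$, each with an arity $ar(f)\ge 1$. A general-valued $\tau$-structure $A$ consists of a finite domain $D=D(A)$ and a function $f^A:D^{ar(f)}\to\overline{\mathbb Q}_{\ge 0}$ for each $f\in\tau$. An instance $I$ of VCSP$(A)$ consists of a finite set $X$ of variables and a function $f^I:X^{ar(f)}\to\mathbb Q_{\ge 0}$ for each $f\in\tau$; $\mathrm{opt}_A(I)$ is the minimum over all $h:X\to D$ of $\sum_{f\in\tau,\ \bar x\in X^{ar(f)}} f^I(\bar x)\,f^A(h(\bar x))$ (maps are applied to tuples component-wise; a minimum over an empty set is $\infty$). \emph{BLP$_g$.} For a tuple $\bar x$ let $\{\bar x\}$ be the set of its entries. A family $(D_x)_{x\in X}$ of subsets of $D$ is arc consistent for $I$ if for all $f$ and $\bar x$ with $f^I(\bar x)\neq 0$, all $y\in\{\bar x\}$ and all $a\in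 D_y$ there is $\sigma:\{\bar x\}\to D$ with $\sigma(y)=a$, $\sigma(z)\in D_z$ for all $z\in\{\bar x\}$, and $f^A(\sigma(\bar x))<\infty$. Arc consistency replaces the domain of every variable by its domain $D_x$ in the largest arc consistent family. Then BLP is solved: BLP$_g(I,A)$ is the optimum ($\infty$ if infeasible) of the linear program in real variables $\lambda_{f,\bar x,\sigma}$ ($\sigma:\{\bar x\}\to D$) and $\mu_x(a)$, \[\min\ \sum_{f,\bar x}\ \sum_{\sigma:\{\bar x\}\to D} f^I(\bar x)\,f^A(\sigma(\bar x))\,\lambda_{f,\bar x,\sigma}\] subject to $\sum_{\sigma:\sigma(x)=a}\lambda_{f,\bar x,\sigma}=\mu_x(a)$ for all $f$, $\bar x$, $x\in\{\bar x\}$, $a\in D$; $\sum_{a\in D}\mu_x(a)=1$ for all $x\in X$; $0\le\lambda,\mu\le 1$; and $\mu_x(a)=0$ whenever $a\notin D_x$. We say that BLP$_g$ solves VCSP$(A)$ if BLP$_g(I,A)=\mathrm{opt}_A(I)$ for every instance $I$ of VCSP$(A)$. \emph{Fractional homomorphisms.} $A\to_f B$ means that there is $\omega:D(B)^{D(A)}\to\mathbb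 Q_{\ge 0}$ with $\sum_g\omega(g)=1$ and $\sum_g\omega(g)f^B(g(\bar a))\le f^A(\bar a)$ for all $f\in\tau$, $\bar a\in D(A)^{ar(f)}$. For $m\ge 1$, $P^m(A)$ is the general-valued $\tau$-structure whose domain is the set of multisets of size $m$ of elements of $D$, with \[f^{P^m(A)}(\alpha_1,\dots,\alpha_k)=\frac1m\ \min_{\bar t_i\in D^m:\,[\bar t_i]=\alpha_i}\ \sum_{i=1}^m f^A(\bar t_1[i],\dots,\bar t_k[i]),\] where $[\bar t]$ is the multiset of entries of $\bar t$. \emph{Fractional polymorphisms.} For $k\ge 1$, a $k$-ary fractional polymorphism of $A$ is a function $\omega$ from the set of operations $g:D^k\to D$ to $\mathbb Q_{\ge 0}$ with $\sum_g\omega(g)=1$ and $\sum_g\omega(g)f^A(g(\bar a_1,\dots,\bar a_k))\le\frac1k\sum_{i=1}^k f^A(\bar a_i)$ for all $f\in\tau$ and $\bar a_1,\dots,\bar a_k\in D^{ar(f)}$. Its support is $\mathrm{supp}(\omega)=\{g:\omega(g)>0\}$. An operation is symmetric if it is invariant under all permutations of its arguments; $\omega$ is totally symmetric if every $g\in\mathrm{supp}(\omega)$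 is symmetric. A set of operations generates $t$ if $t$ lies in the smallest set of operations that contains it and all projections and is closed under superposition $h[g_1,\dots,g_n](\bar x)=h(g_1(\bar x),\dots,g_n(\bar x))$. \textbf{Theorem.} Let $A$ be a general-valued structure with a finite domain over a finite signature. The following are equivalent: \begin{enumerate} \item[(i)] BLP$_g$ solves VCSP$(A)$. \item[(ii)] For every $m>1$, $P^m(A)\to_f A$. \item[(iii)] For every $m>1$, $A$ has an $m$-ary totally symmetric fractional polymorphism. \item[(iv)] For every $n>1$, $A$ has a fractional polymorphism $\omega_n$ (of some arity $k\ge 1$) such that $\mathrm{supp}(\omega_n)$ generates an $n$-ary symmetric operation. \end{enumerate} -/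

import Mathlib

open scoped NNRat NNReal ENNReal

universe u v w

namespace VCSP

/-- A signature: a collection of function symbols, each with a positive arity. -/
structure Signature where
  Symbol : Type v
  arity : Symbol → ℕ
  arity_pos : ∀ f, 0 < arity f

/-- The extended non-negative rationals `ℚ≥0 ∪ {∞}`. In Mathlib's arithmetic on `WithTop`,
`c + ⊤ = ⊤ + c = ⊤` and `0 * ⊤ = ⊤ * 0 = 0`. -/
abbrev Cost : Type := WithTop ℚ≥0

/-- A general-valued structure with domain `D`: an interpretation of every function symbol
as a cost function with values in `ℚ≥0 ∪ {∞}`. -/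
structure GenStructure (S : Signature.{v}) (D : Type u) where
  cost : (f : S.Symbol) → (Fin (S.arity f) → D) → Cost

/-- An instance with set of variables `X`: a finite-valued structure with domain `X`, that is,
a non-negative rational weight for every function symbol and every scope. -/
structure Instance (S : Signature.{v}) (X : Type u) where
  weight : (f : S.Symbol) → (Fin (S.arity f) → X) → ℚ≥0

section Optimum

variable {S : Signature.{v}} [Fintype S.Symbol] {D : Type u} [Fintype D] [DecidableEq D]
  {X : Type w} [Fintype X] [DecidableEq X]

/-- The measure of a solution `h`. -/
def measure (I : Instance S X) (A : GenStructure S D) (h : X → D) : Cost :=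
  ∑ f : S.Symbol, ∑ x : Fin (S.arity f) → X, (I.weight f x : Cost) * A.cost f (h ∘ x)

/-- The minimum measure of a solution. -/
def opt (I : Instance S X) (A : GenStructure S D) : Cost :=
  (Finset.univ : Finset (X → D)).inf (measure I A)

end Optimum

section Fractional

variable {S : Signature.{v}} {D : Type u} [Fintype D] [DecidableEq D]
  {E : Type w} [Fintype E] [DecidableEq E]

/-- `ω` is a fractional homomorphism from `A` to `B`. -/
structure IsFractionalHom (A : GenStructure S D) (B : GenStructure S E)
    (ω : (D → E) → ℚ≥0) : Prop where
  sum_eq_one : ∑ g, ω g = 1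
  le : ∀ (f : S.Symbol) (a : Fin (S.arity f) → D),
    ∑ g : D → E, (ω g : Cost) * B.cost f (g ∘ a) ≤ A.cost f a

/-- There is a fractional homomorphism from `A` to `B`. -/
def FracHom (A : GenStructure S D) (B : GenStructure S E) : Prop :=
  ∃ ω : (D → E) → ℚ≥0, IsFractionalHom A B ω

/-- The `m`-ary operations on `D`. -/
abbrev Op (D : Type u) (m : ℕ) : Type u := (Fin m → D) → D

/-- `ω` is an `m`-ary fractional polymorphism of `A` (for `m ≥ 1`). The operation `g` is applied
component-wise to the tuples `a 0, …, a (m - 1)`. -/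
structure IsFractionalPolymorphism (A : GenStructure S D) (m : ℕ)
    (ω : Op D m → ℚ≥0) : Prop where
  sum_eq_one : ∑ g, ω g = 1
  le : ∀ (f : S.Symbol) (a : Fin m → Fin (S.arity f) → D),
    ∑ g : Op D m, (ω g : Cost) * A.cost f (fun j => g (fun i => a i j)) ≤
      ((1 / (m : ℚ≥0) : ℚ≥0) : Cost) * ∑ i : Fin m, A.cost f (a i)

/-- The support of a fractional operation. -/
def supp {m : ℕ} (ω : Op D m → ℚ≥0) : Set (Op D m) := {g | 0 < ω g}

/-- Symmetric operations: invariant under all permutations of the arguments. -/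
def IsSymmetric {m : ℕ} (g : Op D m) : Prop :=
  ∀ (π : Equiv.Perm (Fin m)) (x : Fin m → D), g (fun i => x (π i)) = g x

/-- `A` has an `m`-ary totally symmetric fractional polymorphism. -/
def HasTotallySymmetric (A : GenStructure S D) (m : ℕ) : Prop :=
  ∃ ω : Op D m → ℚ≥0, IsFractionalPolymorphism A m ω ∧ ∀ g ∈ supp ω, IsSymmetric g

end Fractional

section Clones

variable {D : Type u}

/-- The superposition `h[g₁, …, gₙ]`. -/
def superpose {n m : ℕ} (h : Op D n) (g : Fin n → Op D m) : Op D m :=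
  fun x => h (fun i => g i x)

/-- A clone: a set of operations (of all arities) that contains all projections and is closed
under superposition. -/
structure IsClone (C : Set (Σ n : ℕ, Op D n)) : Prop where
  proj : ∀ (n : ℕ) (i : Fin n), (⟨n, fun x => x i⟩ : Σ n : ℕ, Op D n) ∈ C
  superpose : ∀ (n m : ℕ) (h : Op D n) (g : Fin n → Op D m),
    (⟨n, h⟩ : Σ n : ℕ, Op D n) ∈ C → (∀ i, (⟨m, g i⟩ : Σ n : ℕ, Op D n) ∈ C) →
      (⟨m, VCSP.superpose h g⟩ : Σ n : ℕ, Op D n) ∈ C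

/-- The set `F` of `k`-ary operations generates the `n`-ary operation `t`: the operation `t`
lies in the smallest clone that contains `F`. -/
def Generates {k n : ℕ} (F : Set (Op D k)) (t : Op D n) : Prop :=
  ∀ C : Set (Σ n : ℕ, Op D n), IsClone C →
    (∀ g ∈ F, (⟨k, g⟩ : Σ n : ℕ, Op D n) ∈ C) → (⟨n, t⟩ : Σ n : ℕ, Op D n) ∈ C

end Clones

section MultisetStructure

variable {S : Signature.{v}} {D : Type u} [Fintype D] [DecidableEq D]

/-- The multiset-structure `P^m(A)`, whose domain `Sym D m` consists of the multisets of size `m`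
of elements of `D`. The minimum runs over all ways to order each multiset `α j` as an
`m`-tuple `t j`; this range is finite and never empty. -/
def multisetStructure (m : ℕ) (A : GenStructure S D) : GenStructure S (Sym D m) where
  cost f α := ((1 / (m : ℚ≥0) : ℚ≥0) : Cost) *
    (Finset.univ.filter (fun t : Fin (S.arity f) → Fin m → D =>
        ∀ j, Multiset.map (t j) Finset.univ.val = (α j : Multiset D))).inf
      (fun t => ∑ i : Fin m, A.cost f (fun j => t j i))

end MultisetStructure

section LinearProgram

variable {S : Signature.{v}} {D : Type u} {X : Type w}

/-- The tuple `σ(x̄)` for an assignment `σ : {x̄} → D` to the variables occurring in `x̄`. -/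
def applyScope {k : ℕ} {x : Fin k → X} (σ : Set.range x → D) : Fin k → D :=
  fun j => σ ⟨x j, Set.mem_range_self j⟩

/-- A family of domains (one for each variable) is arc consistent if for every constraint, i.e.
scope `x` of non-zero weight, each value `a` in the domain of a variable `y` of the scope
extends to an assignment to all variables of the scope, with values in their domains, under
which the constraint has finite cost. -/
def ArcConsistent (I : Instance S X) (A : GenStructure S D) (dom : X → Set D) : Prop :=
  ∀ (f : S.Symbol) (x : Fin (S.arity f) → X), I.weight f x ≠ 0 →
    ∀ (y : Set.range x) (a : D), a ∈ dom y →
      ∃ σ : Set.range x → D, σ y = a ∧ (∀ z : Set.range x, σ z ∈ dom z) ∧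
        A.cost f (applyScope σ) ≠ ⊤

/-- The outcome of arc consistency: the largest arc consistent family of domains. -/
def acDomain (I : Instance S X) (A : GenStructure S D) (y : X) : Set D :=
  {a | ∃ dom : X → Set D, ArcConsistent I A dom ∧ a ∈ dom y}

theorem arcConsistent_acDomain (I : Instance S X) (A : GenStructure S D) :
    ArcConsistent I A (acDomain I A) := by
  rintro f x hw y a ⟨dom, hdom, ha⟩
  obtain ⟨σ, h1, h2, h3⟩ := hdom f x hw y a ha
  exact ⟨σ, h1, fun z => ⟨dom, hdom, h2 z⟩, h3⟩

/-- The variables `λ` and `μ` of the basic linear programming relaxation. -/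
structure LPPoint (S : Signature.{v}) (X : Type w) (D : Type u) where
  lam : (f : S.Symbol) → (x : Fin (S.arity f) → X) → (Set.range x → D) → ℝ≥0
  mu : X → D → ℝ≥0

variable [Fintype D] [DecidableEq D] [Fintype X] [DecidableEq X]

/-- The constraints of the basic linear programming relaxation. -/
structure LPPoint.IsFeasible (p : LPPoint S X D) : Prop where
  marginal : ∀ (f : S.Symbol) (x : Fin (S.arity f) → X) (y : Set.range x) (a : D),
    ∑ σ ∈ Finset.univ.filter (fun σ : Set.range x → D => σ y = a), p.lam f x σ = p.mu y a
  sum_mu : ∀ y : X, ∑ a : D, p.mu y a = 1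
  lam_le_one : ∀ f x σ, p.lam f x σ ≤ 1
  mu_le_one : ∀ y a, p.mu y a ≤ 1

/-- The embedding of `ℚ≥0 ∪ {∞}` into `[0, ∞]`. -/
noncomputable def Cost.toENNReal : Cost → ℝ≥0∞ :=
  WithTop.recTopCoe ⊤ (fun q : ℚ≥0 => ((q : ℝ≥0) : ℝ≥0∞))

variable [Fintype S.Symbol]

/-- The objective function of the basic linear programming relaxation, with `0 * ∞ = 0`. -/
noncomputable def LPPoint.objective (I : Instance S X) (A : GenStructure S D)
    (p : LPPoint S X D) : ℝ≥0∞ :=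
  ∑ f : S.Symbol, ∑ x : Fin (S.arity f) → X, ∑ σ : Set.range x → D,
    Cost.toENNReal (I.weight f x : Cost) * Cost.toENNReal (A.cost f (applyScope σ)) *
      (p.lam f x σ : ℝ≥0∞)

/-- The optimum of the basic linear programming relaxation when the domain of each variable `y`
is restricted to `dom y`. The optimum of an infeasible program is `∞`. -/
noncomputable def blpOn (dom : X → Set D) (I : Instance S X) (A : GenStructure S D) : ℝ≥0∞ :=
  ⨅ (p : LPPoint S X D) (_ : p.IsFeasible) (_ : ∀ y, ∀ a, a ∉ dom y → p.mu y a = 0),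
    p.objective I A

/-- The value computed by `BLP_g`: first make the instance arc consistent, then solve the basic
linear programming relaxation of the resulting instance. If some domain becomes empty, the linear
program is infeasible and the value is `∞`. -/
noncomputable def blpG (I : Instance S X) (A : GenStructure S D) : ℝ≥0∞ :=
  blpOn (acDomain I A) I A

end LinearProgram

section Characterisation

variable {S : Signature.{v}} {D : Type u} [Fintype D] [DecidableEq D]

/-- `BLP_g` solves `VCSP(A)`: on every (finite) instance it computes the optimum. -/
def BLPgSolves [Fintype S.Symbol] (A : GenStructure S D) : Prop :=
  ∀ (X : Type u) [Fintype X] [DecidableEq X] (I : Instance S X),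
    blpG I A = Cost.toENNReal (opt I A)

/-- `A` has a fractional polymorphism (of some arity `k ≥ 1`) whose support generates an `n`-ary
symmetric operation. -/
def GeneratesSymmetric (A : GenStructure S D) (n : ℕ) : Prop :=
  ∃ k : ℕ, 0 < k ∧ ∃ ω : Op D k → ℚ≥0, IsFractionalPolymorphism A k ω ∧
    ∃ t : Op D n, IsSymmetric t ∧ Generates (supp ω) t

end Characterisation

end VCSP

set_option linter.unusedSectionVars false

namespace VCSP

/-! ### Extended rational costs as a subsemiring of `[0, ∞]` -/

section CostEmbedding

/-! (ii) ⇒ (iii) ⇒ (iv) is formal: an operation that factors through multisets is symmetric, and a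
member of a support is generated by it. Arc consistency never changes the value of the program,
because the support of a feasible point of finite cost is arc consistent (`blpG_le_objective`).

(iv) ⇒ (i). Take an optimal point `p` whose support contains that of every other optimal point
(`exists_isMin_max_support`). A fractional polymorphism acts on feasible points by independent
sampling without raising the objective (`LPPoint.objective_act_le`), so by maximality the operations
in its support, and all that they generate, preserve the support of `p`. Clearing denominators in
the marginal equations gives `N` rows for each scope, inside the support of `p`, such that the
multiset in a column depends only on its variable (`LPPoint.IsFeasible.exists_rows`). An `N`-ary
symmetric operation collapses the rows to one assignment supported in `p`, which is then optimal as
well (`LPPoint.objective_le_of_support`). There is no control over `N`, hence the quantifier over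
all arities.

(i) ⇒ (ii). If there is no fractional homomorphism, duality gives an instance on multisets for which
the identity, measured in `P^m(A)`, is strictly cheaper than every map `g` measured in `A`
(`exists_instance_of_not_fracHom`). Optimal orderings of the multisets suggest a fractional solution
of the same cost, but a scope may repeat a multiset under different orderings, which an assignment
to its variables cannot express. So each variable is replaced by many copies. By pigeonhole an
optimal assignment `h` of the copies takes some value `g y` on many copies of `y`. Averaging `h`
over all choices of copies gives a point that is LP-optimal by (i) and has `g` in its support. Hence
`g` costs no more than the fractional solution, a contradiction. -/

@[simp] theorem Cost.toENNReal_top : Cost.toENNReal ⊤ = ⊤ := rfl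

@[simp] theorem Cost.toENNReal_coe (q : ℚ≥0) :
    Cost.toENNReal (q : Cost) = ((q : ℝ≥0) : ℝ≥0∞) := rfl

@[simp] theorem Cost.toENNReal_zero : Cost.toENNReal 0 = 0 := by
  have := Cost.toENNReal_coe 0
  simpa using this

theorem Cost.toENNReal_add (a b : Cost) :
    Cost.toENNReal (a + b) = Cost.toENNReal a + Cost.toENNReal b := by
  induction a using WithTop.recTopCoe with
  | top => simp
  | coe a =>
    induction b using WithTop.recTopCoe with
    | top => simp
    | coe b => rw [← WithTop.coe_add]; simp only [Cost.toENNReal_coe]; push_cast; rfl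

theorem Cost.toENNReal_eq_zero {a : Cost} : Cost.toENNReal a = 0 ↔ a = 0 := by
  induction a using WithTop.recTopCoe with
  | top => simp
  | coe a => simp

theorem Cost.toENNReal_mul (a b : Cost) :
    Cost.toENNReal (a * b) = Cost.toENNReal a * Cost.toENNReal b := by
  induction a using WithTop.recTopCoe with
  | top =>
    by_cases hb : b = 0
    · simp [hb]
    · rw [WithTop.top_mul hb, Cost.toENNReal_top, ENNReal.top_mul]
      rwa [Ne, Cost.toENNReal_eq_zero]
  | coe a =>
    induction b using WithTop.recTopCoe with
    | top =>
      by_cases ha : (a : Cost) = 0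
      · simp [ha]
      · rw [WithTop.mul_top ha, Cost.toENNReal_top, ENNReal.mul_top]
        rwa [Ne, Cost.toENNReal_eq_zero]
    | coe b => rw [← WithTop.coe_mul]; simp only [Cost.toENNReal_coe]; push_cast; rfl

theorem Cost.toENNReal_sum {ι : Type*} (s : Finset ι) (g : ι → Cost) :
    Cost.toENNReal (∑ i ∈ s, g i) = ∑ i ∈ s, Cost.toENNReal (g i) :=
  map_sum (⟨⟨Cost.toENNReal, Cost.toENNReal_zero⟩, Cost.toENNReal_add⟩ : Cost →+ ℝ≥0∞) g s

theorem Cost.toENNReal_le {a b : Cost} : Cost.toENNReal a ≤ Cost.toENNReal b ↔ a ≤ b := by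
  induction b using WithTop.recTopCoe with
  | top => simp
  | coe b =>
    induction a using WithTop.recTopCoe with
    | top => simp
    | coe a => simp [WithTop.coe_le_coe]

end CostEmbedding

/-! ### Integral points, arc consistency and optimal faces -/

section Program

variable {S : Signature.{v}} {D : Type u} [Fintype D] [DecidableEq D]
  {X : Type w} [Fintype X] [DecidableEq X]

/-- The point of the linear program that corresponds to an assignment. -/
def integralPoint (S : Signature.{v}) (h : X → D) : LPPoint S X D where
  lam _ _ σ := if σ = (fun z => h z.1) then 1 else 0
  mu y a := if a = h y then 1 else 0

theorem integralPoint_isFeasible (h : X → D) : (integralPoint S h).IsFeasible where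
  marginal f x y a := by
    simp only [integralPoint, Finset.sum_ite_eq', Finset.mem_filter, Finset.mem_univ, true_and]
    simp [eq_comm]
  sum_mu y := by simp [integralPoint]
  lam_le_one f x σ := by simp only [integralPoint]; split_ifs <;> simp
  mu_le_one y a := by simp only [integralPoint]; split_ifs <;> simp

/-- The upper bounds by 1 are redundant: each `μ` is a summand of a sum equal to 1, and each `λ` a
summand of some `μ` because arities are positive. -/
theorem LPPoint.isFeasible_of_marginal {p : LPPoint S X D}
    (hmarg : ∀ (f : S.Symbol) (x : Fin (S.arity f) → X) (y : Set.range x) (a : D),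
      ∑ σ ∈ Finset.univ.filter (fun σ : Set.range x → D => σ y = a), p.lam f x σ = p.mu y a)
    (hsum : ∀ y, ∑ a : D, p.mu y a = 1) : p.IsFeasible := by
  have hmu : ∀ y a, p.mu y a ≤ 1 := fun y a => by
    rw [← hsum y]
    exact Finset.single_le_sum (f := fun a => p.mu y a) (fun _ _ => zero_le) (Finset.mem_univ a)
  refine ⟨hmarg, hsum, fun f x σ => ?_, hmu⟩
  let y : Set.range x := ⟨x ⟨0, S.arity_pos f⟩, Set.mem_range_self _⟩
  refine le_trans ?_ (hmu y (σ y))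
  rw [← hmarg f x y (σ y)]
  exact Finset.single_le_sum (f := fun σ => p.lam f x σ) (fun _ _ => zero_le) (by simp)

theorem LPPoint.IsFeasible.lam_le_mu {p : LPPoint S X D} (hp : p.IsFeasible) (f : S.Symbol)
    (x : Fin (S.arity f) → X) (σ : Set.range x → D) (y : Set.range x) :
    p.lam f x σ ≤ p.mu y (σ y) := by
  rw [← hp.marginal f x y (σ y)]
  exact Finset.single_le_sum (f := fun σ => p.lam f x σ) (fun _ _ => zero_le) (by simp)

variable [Fintype S.Symbol]

theorem objective_integralPoint (I : Instance S X) (A : GenStructure S D) (h : X → D) :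
    (integralPoint S h).objective I A = Cost.toENNReal (measure I A h) := by
  simp only [LPPoint.objective, measure, Cost.toENNReal_sum, Cost.toENNReal_mul]
  refine Finset.sum_congr rfl fun f _ => Finset.sum_congr rfl fun x _ => ?_
  rw [Finset.sum_eq_single (fun z => h z.1)]
  · simp only [integralPoint, if_true, ENNReal.coe_one, mul_one]
    rfl
  · intro σ _ hσ
    simp [integralPoint, hσ]
  · simp

theorem LPPoint.lam_eq_zero_of_objective_ne_top {p : LPPoint S X D} {I : Instance S X}
    {A : GenStructure S D} (hp : p.objective I A ≠ ⊤) {f : S.Symbol}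
    {x : Fin (S.arity f) → X} (hw : I.weight f x ≠ 0) {σ : Set.range x → D}
    (hσ : A.cost f (applyScope σ) = ⊤) : p.lam f x σ = 0 := by
  by_contra hne
  apply hp
  unfold LPPoint.objective
  refine ENNReal.sum_eq_top.2 ⟨f, Finset.mem_univ _, ENNReal.sum_eq_top.2
    ⟨x, Finset.mem_univ _, ENNReal.sum_eq_top.2 ⟨σ, Finset.mem_univ _, ?_⟩⟩⟩
  rw [hσ, Cost.toENNReal_top, ENNReal.mul_top, ENNReal.top_mul]
  · simpa using hne
  · simpa using hw

/-- Enforcing arc consistency does not cut off any point of finite cost. -/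
theorem blpG_le_objective (I : Instance S X) (A : GenStructure S D) {p : LPPoint S X D}
    (hp : p.IsFeasible) : blpG I A ≤ p.objective I A := by
  by_cases htop : p.objective I A = ⊤
  · simp [htop]
  refine iInf_le_of_le p (iInf_le_of_le hp (iInf_le_of_le ?_ le_rfl))
  intro y a ha
  by_contra hne
  -- The supports of the `μ y` are arc consistent: a non-zero marginal comes from some `σ` with
  -- non-zero `λ`, whose cost must be finite.
  refine ha ⟨fun y => {a | p.mu y a ≠ 0}, ?_, hne⟩
  intro f x hw y a hya
  rw [Set.mem_ofPred_eq, ← hp.marginal f x y a] at hya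
  obtain ⟨σ, hσ, hσ0⟩ := Finset.exists_ne_zero_of_sum_ne_zero hya
  refine ⟨σ, (Finset.mem_filter.1 hσ).2, fun z hz => hσ0 ?_, fun h => hσ0 ?_⟩
  · exact le_antisymm (hz ▸ hp.lam_le_mu f x σ z) (zero_le)
  · exact LPPoint.lam_eq_zero_of_objective_ne_top htop hw h

theorem blpG_le_opt (I : Instance S X) (A : GenStructure S D) :
    blpG I A ≤ Cost.toENNReal (opt I A) := by
  by_cases hne : Nonempty (X → D)
  · obtain ⟨h, -, hh⟩ := Finset.exists_mem_eq_inf Finset.univ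
      (Finset.univ_nonempty (α := X → D)) (measure I A)
    rw [opt, hh, ← objective_integralPoint]
    exact blpG_le_objective I A (integralPoint_isFeasible h)
  · rw [not_nonempty_iff] at hne
    simp [opt]

/-- If a minimiser is in the relative interior of a segment of feasible points, then the
end point of that segment is a minimiser as well. -/
theorem LPPoint.objective_le_of_support {I : Instance S X} {A : GenStructure S D}
    {p u : LPPoint S X D} (hp : p.IsFeasible) (hu : u.IsFeasible)
    (hmin : ∀ q : LPPoint S X D, q.IsFeasible → p.objective I A ≤ q.objective I A)
    (hlam : ∀ f x σ, p.lam f x σ = 0 → u.lam f x σ = 0)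
    (hmu : ∀ y a, p.mu y a = 0 → u.mu y a = 0) :
    u.objective I A ≤ p.objective I A := by
  by_cases htop : p.objective I A = ⊤
  · simp [htop]
  have key : ∀ a b : ℝ≥0, (a = 0 → b = 0) → ∀ᶠ s : ℝ≥0 in nhdsWithin 0 (Set.Ioi 0), s * b ≤ a := by
    intro a b hab
    rcases eq_or_ne a 0 with ha | ha
    · simp [hab ha]
    · have : Filter.Tendsto (fun s : ℝ≥0 => s * b) (nhds 0) (nhds (0 * b)) :=
        (continuous_mul_const b).tendsto 0
      rw [zero_mul] at this
      exact nhdsWithin_le_nhds ((this.eventually_lt_const (pos_iff_ne_zero.2 ha)).mono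
        fun _ h => h.le)
  have h1 : ∀ᶠ s : ℝ≥0 in nhdsWithin 0 (Set.Ioi 0), ∀ f x σ, s * u.lam f x σ ≤ p.lam f x σ := by
    simp only [Filter.eventually_all]
    exact fun f x σ => key _ _ (hlam f x σ)
  have h2 : ∀ᶠ s : ℝ≥0 in nhdsWithin 0 (Set.Ioi 0), ∀ y a, s * u.mu y a ≤ p.mu y a := by
    simp only [Filter.eventually_all]
    exact fun y a => key _ _ (hmu y a)
  have h3 : ∀ᶠ s : ℝ≥0 in nhdsWithin 0 (Set.Ioi 0), s < 1 :=
    nhdsWithin_le_nhds (eventually_lt_nhds zero_lt_one)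
  obtain ⟨s, ⟨⟨h1, h2⟩, h3⟩, hs⟩ := (((h1.and h2).and h3).and self_mem_nhdsWithin).exists
  have hs0 : s ≠ 0 := ne_of_gt hs
  obtain ⟨r, hr0, hr⟩ : ∃ r : ℝ≥0, r ≠ 0 ∧ s + r = 1 :=
    ⟨1 - s, (tsub_pos_of_lt h3).ne', add_tsub_cancel_of_le h3.le⟩
  -- Prolong the segment from `u` to `p` slightly beyond `p`. Then `p = s u + r q` with `q`
  -- feasible, and minimality against `q` forces `u` to cost no more than `p`.
  let q : LPPoint S X D :=
    { lam := fun f x σ => (p.lam f x σ - s * u.lam f x σ) / r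
      mu := fun y a => (p.mu y a - s * u.mu y a) / r }
  have ql : ∀ f x σ, s * u.lam f x σ + r * q.lam f x σ = p.lam f x σ := by
    intro f x σ
    simp only [q]
    rw [mul_div_cancel₀ _ hr0, add_tsub_cancel_of_le (h1 f x σ)]
  have qm : ∀ y a, s * u.mu y a + r * q.mu y a = p.mu y a := by
    intro y a
    simp only [q]
    rw [mul_div_cancel₀ _ hr0, add_tsub_cancel_of_le (h2 y a)]
  have qmarg : ∀ (f : S.Symbol) (x : Fin (S.arity f) → X) (y : Set.range x) (a : D),
      ∑ σ ∈ Finset.univ.filter (fun σ : Set.range x → D => σ y = a), q.lam f x σ = q.mu y a := by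
    intro f x y a
    have := hp.marginal f x y a
    simp only [← ql, ← qm, Finset.sum_add_distrib, ← Finset.mul_sum, hu.marginal] at this
    exact mul_left_cancel₀ hr0 (add_left_cancel this)
  have qsum : ∀ y, ∑ a : D, q.mu y a = 1 := by
    intro y
    have := hp.sum_mu y
    simp only [← qm, Finset.sum_add_distrib, ← Finset.mul_sum, hu.sum_mu, mul_one] at this
    rw [← hr] at this
    exact mul_left_cancel₀ hr0 ((add_left_cancel this).trans (mul_one r).symm)
  have hq : q.IsFeasible := LPPoint.isFeasible_of_marginal qmarg qsum
  have hobj : p.objective I A = s * u.objective I A + r * q.objective I A := by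
    simp only [LPPoint.objective, Finset.mul_sum, ← Finset.sum_add_distrib]
    refine Finset.sum_congr rfl fun f _ => Finset.sum_congr rfl fun x _ =>
      Finset.sum_congr rfl fun σ _ => ?_
    rw [← ql f x σ]
    push_cast
    ring
  have h4 : (s : ℝ≥0∞) * u.objective I A + r * p.objective I A ≤
      s * p.objective I A + r * p.objective I A := by
    calc _ ≤ (s : ℝ≥0∞) * u.objective I A + r * q.objective I A := by gcongr; exact hmin q hq
      _ = p.objective I A := hobj.symm
      _ = ((s + r : ℝ≥0) : ℝ≥0∞) * p.objective I A := by rw [hr]; simp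
      _ = _ := by push_cast; ring
  have h5 := (ENNReal.add_le_add_iff_right (ENNReal.mul_ne_top ENNReal.coe_ne_top htop)).1 h4
  exact (ENNReal.mul_le_mul_iff_right (by simpa using hs0) ENNReal.coe_ne_top).1 h5

end Program

/-! ### From real to rational and integral solutions -/

section Rational

/-- Finitely many non-negative reals can be replaced by natural numbers in such a way that all
rational linear relations and the set of non-zero members are preserved. -/
theorem exists_linearMap_nat {ι : Type*} [Finite ι] (r : ι → ℝ) (hr : ∀ i, 0 ≤ r i) :
    ∃ φ : ℝ →ₗ[ℚ] ℚ, ∀ i, ∃ k : ℕ, φ (r i) = k ∧ (r i ≠ 0 → k ≠ 0) := by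
  classical
  have := Fintype.ofFinite ι
  let b := Module.Basis.ofVectorSpace ℚ ℝ
  -- Each `r i` is a rational linear form in finitely many elements of a `ℚ`-basis of `ℝ`. Moving
  -- the basis elements to nearby rationals keeps the finitely many non-zero forms positive.
  let F : ι → (Module.Basis.ofVectorSpaceIndex ℚ ℝ → ℝ) → ℝ := fun i s =>
    ∑ j ∈ (b.repr (r i)).support, ((b.repr (r i) j : ℚ) : ℝ) * s j
  have hFb : ∀ i, F i (fun j => b j) = r i := by
    intro i
    conv_rhs => rw [← b.linearCombination_repr (r i), Finsupp.linearCombination_apply]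
    simp only [F, Finsupp.sum, Rat.smul_def]
  have hopen : IsOpen {s | ∀ i, r i ≠ 0 → 0 < F i s} := by
    simp only [Set.ofPred_forall]
    refine isOpen_iInter_of_finite fun i => isOpen_iInter_of_finite fun _ =>
      isOpen_lt continuous_const ?_
    simp only [F]
    fun_prop
  have hdense : DenseRange (Pi.map fun (_ : Module.Basis.ofVectorSpaceIndex ℚ ℝ) (q : ℚ) => (q : ℝ)) :=
    DenseRange.piMap fun _ => Rat.denseRange_cast
  obtain ⟨s, hs⟩ := hdense.exists_mem_open hopen
    ⟨fun j => b j, fun i hi => by rw [hFb]; exact lt_of_le_of_ne (hr i) hi.symm⟩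
  let φ : ℝ →ₗ[ℚ] ℚ := b.constr ℚ s
  have hφ : ∀ i, ((φ (r i) : ℚ) : ℝ) = F i (Pi.map (fun _ (q : ℚ) => (q : ℝ)) s) := by
    intro i
    simp only [φ, Module.Basis.constr_apply, F, Finsupp.sum, smul_eq_mul, Pi.map_apply]
    push_cast
    rfl
  have hpos : ∀ i, r i ≠ 0 → 0 < φ (r i) := by
    intro i hi
    have := hs i hi
    rw [← hφ] at this
    exact_mod_cast this
  have hnonneg : ∀ i, 0 ≤ φ (r i) := by
    intro i
    by_cases hi : r i = 0
    · simp [hi]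
    · exact (hpos i hi).le
  refine ⟨((∏ i, (φ (r i)).den : ℕ) : ℚ) • φ, fun i => ?_⟩
  have hint : (((φ (r i)).den : ℚ)) * φ (r i) = ((φ (r i)).num.toNat : ℕ) := by
    rw [Rat.den_mul_eq_num]
    have := Int.toNat_of_nonneg (Rat.num_nonneg.2 (hnonneg i))
    exact_mod_cast this.symm
  have hk : (((∏ i, (φ (r i)).den : ℕ) : ℚ) • φ) (r i) =
      (((∏ j ∈ Finset.univ.erase i, (φ (r j)).den) * (φ (r i)).num.toNat : ℕ) : ℚ) := by
    rw [LinearMap.smul_apply, smul_eq_mul, ← Finset.prod_erase_mul _ _ (Finset.mem_univ i)]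
    push_cast
    rw [mul_assoc, hint]
  refine ⟨_, hk, fun hi => ?_⟩
  have hden : ((∏ i, (φ (r i)).den : ℕ) : ℚ) ≠ 0 :=
    Nat.cast_ne_zero.2 (Finset.prod_ne_zero_iff.2 fun i _ => (φ (r i)).den_nz)
  intro h0
  rw [h0, LinearMap.smul_apply, smul_eq_mul, Nat.cast_zero] at hk
  exact (mul_ne_zero hden (hpos i hi).ne') hk

/-- The theorem of the alternative for rational matrix games. -/
theorem exists_mixed_strategy_or {R G : Type*} [Fintype R] [Fintype G] (M : R → G → ℚ) :
    (∃ ω : G → ℚ≥0, ∑ g, ω g = 1 ∧ ∀ r, ∑ g, (ω g : ℚ) * M r g ≤ 0) ∨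
      ∃ c : R → ℚ≥0, (∀ r, c r ≠ 0) ∧ ∀ g, 0 < ∑ r, (c r : ℚ) * M r g := by
  classical
  let T : (G → ℝ) →ₗ[ℝ] (R → ℝ) := Matrix.mulVecLin (Matrix.of fun r g => (M r g : ℝ))
  have hT : ∀ x r, T x r = ∑ g, (M r g : ℝ) * x g := fun x r => rfl
  -- Either some mixed strategy has only non-positive payoffs, or a hyperplane separates the payoff
  -- vectors from the non-positive orthant.
  by_cases hd : Disjoint (T '' stdSimplex ℝ G) (Set.Iic 0)
  · right
    obtain ⟨f, u, w, h1, h2, h3⟩ := geometric_hahn_banach_compact_closed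
      ((convex_stdSimplex ℝ G).linear_image T)
      ((isCompact_stdSimplex ℝ G).image T.continuous_of_finiteDimensional)
      (convex_Iic (𝕜 := ℝ) (0 : R → ℝ)) isClosed_Iic hd
    have hw0 : w < 0 := by simpa using h3 0 (Set.mem_Iic.2 le_rfl)
    have hneg : ∀ r, f (Pi.single r 1) ≤ 0 := by
      intro r
      by_contra hr
      rw [not_le] at hr
      -- This multiple of a basis vector lies in the orthant, yet `f` takes exactly the excluded
      -- value `w` there.
      have := h3 ((w / f (Pi.single r 1)) • Pi.single r 1) (by
        rw [Set.mem_Iic]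
        refine smul_nonpos_of_nonpos_of_nonneg (div_nonpos_of_nonpos_of_nonneg hw0.le hr.le) ?_
        exact Pi.single_nonneg.2 zero_le_one)
      rw [map_smul, smul_eq_mul, div_mul_cancel₀ _ hr.ne'] at this
      exact lt_irrefl _ this
    have hpos : ∀ g, 0 < ∑ r, -f (Pi.single r 1) * (M r g : ℝ) := by
      intro g
      have hg := h1 (T (Pi.single g 1)) ⟨_, single_mem_stdSimplex ℝ g, rfl⟩
      have : T (Pi.single g 1) = ∑ r, (M r g : ℝ) • Pi.single r (1 : ℝ) := by
        ext r
        simp [hT, Pi.single_apply]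
      rw [this, map_sum] at hg
      simp only [map_smul, smul_eq_mul] at hg
      simp only [neg_mul, Finset.sum_neg_distrib, mul_comm (f _)]
      linarith
    let F : G → (R → ℝ) → ℝ := fun g c => ∑ r, c r * (M r g : ℝ)
    have hF : ∀ g, Continuous (F g) := fun g => by simp only [F]; fun_prop
    have hopen : IsOpen {c : R → ℝ | (∀ r, 0 < c r) ∧ ∀ g, 0 < F g c} := by
      simp only [Set.ofPred_and, Set.ofPred_forall]
      exact (isOpen_iInter_of_finite fun r => isOpen_lt continuous_const (continuous_apply r)).inter
        (isOpen_iInter_of_finite fun g => isOpen_lt continuous_const (hF g))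
    -- The separating weights may vanish, so a small `ε` is added; the strict column inequalities
    -- survive.
    have hne : {c : R → ℝ | (∀ r, 0 < c r) ∧ ∀ g, 0 < F g c}.Nonempty := by
      have hev : ∀ᶠ ε : ℝ in nhdsWithin 0 (Set.Ioi 0),
          ∀ g, 0 < F g (fun r => -f (Pi.single r 1) + ε) := by
        rw [Filter.eventually_all]
        intro g
        have hc : Continuous fun ε : ℝ => F g (fun r => -f (Pi.single r 1) + ε) :=
          (hF g).comp (by fun_prop)
        refine nhdsWithin_le_nhds (hc.continuousAt.eventually (lt_mem_nhds ?_))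
        simpa [F] using hpos g
      obtain ⟨ε, h, hε⟩ := (hev.and self_mem_nhdsWithin).exists
      exact ⟨_, fun r => add_pos_of_nonneg_of_pos (neg_nonneg.2 (hneg r)) hε, h⟩
    have hdense : DenseRange (Pi.map fun (_ : R) (q : ℚ) => (q : ℝ)) :=
      DenseRange.piMap fun _ => Rat.denseRange_cast
    obtain ⟨c, hc1, hc2⟩ := hdense.exists_mem_open hopen hne
    have hc : ∀ r, 0 < c r := fun r => by
      have := hc1 r
      rw [Pi.map_apply] at this
      exact_mod_cast this
    refine ⟨fun r => ⟨c r, (hc r).le⟩, fun r h => (hc r).ne' (congrArg NNRat.cast h), fun g => ?_⟩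
    have := hc2 g
    simp only [F, Pi.map_apply] at this
    exact_mod_cast this
  · left
    rw [Set.not_disjoint_iff] at hd
    obtain ⟨_, ⟨x, hx, rfl⟩, hx0⟩ := hd
    have hs : ∀ r, 0 ≤ -T x r := fun r => neg_nonneg.2 (hx0 r)
    -- A `ℚ`-linear map need not respect order, so the slacks `-T x r` are listed to keep their
    -- signs. The constant 1 supplies the normalising factor.
    obtain ⟨φ, hφ⟩ := exists_linearMap_nat (Sum.elim x (Sum.elim (fun r => -T x r) fun _ : Unit => 1))
      (by rintro (g | r | _) <;> simp [hx.1, hs])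
    choose k hk hk0 using hφ
    have h1 : φ 1 = k (.inr (.inr ())) := hk (.inr (.inr ()))
    have h10 : (k (.inr (.inr ())) : ℚ) ≠ 0 := Nat.cast_ne_zero.2 (hk0 (.inr (.inr ())) one_ne_zero)
    have hxg : ∀ g, φ (x g) = k (.inl g) := fun g => hk (.inl g)
    have hsum : ∑ g, (k (.inl g) : ℚ) = k (.inr (.inr ())) := by
      rw [← h1, ← hx.2, map_sum]
      exact Finset.sum_congr rfl fun g _ => (hxg g).symm
    have hrow : ∀ r, ∑ g, (k (.inl g) : ℚ) * M r g = -k (.inr (.inl r)) := by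
      intro r
      have h2 : φ (-T x r) = k (.inr (.inl r)) := hk (.inr (.inl r))
      rw [← h2, map_neg, neg_neg, hT, map_sum]
      refine Finset.sum_congr rfl fun g _ => ?_
      rw [← hxg, ← Rat.smul_def, map_smul, smul_eq_mul, mul_comm]
    refine ⟨fun g => (k (.inl g) : ℚ≥0) / k (.inr (.inr ())), ?_, fun r => ?_⟩
    · rw [← Finset.sum_div, div_eq_one_iff_eq (by exact_mod_cast h10)]
      exact_mod_cast hsum
    · push_cast
      simp only [div_mul_eq_mul_div]
      rw [← Finset.sum_div, hrow]
      exact div_nonpos_of_nonpos_of_nonneg (by simp) (by simp)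

end Rational

/-! ### Existence of minimisers of maximal support -/

section Minimiser

variable {S : Signature.{v}} [Fintype S.Symbol] {D : Type u} [Fintype D] [DecidableEq D]
  {X : Type w} [Fintype X] [DecidableEq X]

/-- For `c = ∞` the function jumps from 0 at the origin to `∞`, so continuity fails but minima on
compact sets still exist. -/
theorem lowerSemicontinuous_const_mul_coe (c : ℝ≥0∞) :
    LowerSemicontinuous fun t : ℝ≥0 => c * (t : ℝ≥0∞) := by
  rcases eq_or_ne c ⊤ with rfl | hc
  · intro t y hy
    rcases eq_or_ne t 0 with rfl | ht
    · simp at hy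
    · filter_upwards [isOpen_ne.mem_nhds ht] with s hs
      dsimp only at hy ⊢
      rw [ENNReal.top_mul (ENNReal.coe_ne_zero.2 ht)] at hy
      rwa [ENNReal.top_mul (ENNReal.coe_ne_zero.2 hs)]
  · exact ((ENNReal.continuous_const_mul hc).comp ENNReal.continuous_coe).lowerSemicontinuous

/-- The ambient space of the linear program, as a product of real half lines. -/
abbrev LPCoordinates (S : Signature.{v}) (X : Type w) (D : Type u) :=
  ((f : S.Symbol) → (x : Fin (S.arity f) → X) → (Set.range x → D) → ℝ≥0) × (X → D → ℝ≥0)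

/-- The feasible set is closed in a compact box, and the objective is lower semicontinuous even with
infinite coefficients. -/
theorem exists_isFeasible_isMin (I : Instance S X) (A : GenStructure S D)
    (hne : ∃ p : LPPoint S X D, p.IsFeasible) :
    ∃ p : LPPoint S X D, p.IsFeasible ∧
      ∀ q : LPPoint S X D, q.IsFeasible → p.objective I A ≤ q.objective I A := by
  let mk : LPCoordinates S X D → LPPoint S X D := fun z => ⟨z.1, z.2⟩
  have hcl : (∀ f x σ, Continuous fun z : LPCoordinates S X D => (mk z).lam f x σ) ∧
      ∀ y a, Continuous fun z : LPCoordinates S X D => (mk z).mu y a := by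
    simp only [mk]
    exact ⟨fun f x σ => by fun_prop, fun y a => by fun_prop⟩
  have hclosed : IsClosed {z : LPCoordinates S X D | (mk z).IsFeasible} := by
    have : {z : LPCoordinates S X D | (mk z).IsFeasible} =
        (⋂ (f) (x) (y) (a), {z : LPCoordinates S X D | ∑ σ ∈ Finset.univ.filter
          (fun σ : Set.range x → D => σ y = a), (mk z).lam f x σ = (mk z).mu y a}) ∩
        (⋂ y, {z : LPCoordinates S X D | ∑ a : D, (mk z).mu y a = 1}) ∩
        (⋂ (f) (x) (σ), {z : LPCoordinates S X D | (mk z).lam f x σ ≤ 1}) ∩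
        (⋂ (y) (a), {z : LPCoordinates S X D | (mk z).mu y a ≤ 1}) := by
      ext z
      simp only [Set.mem_inter_iff, Set.mem_iInter, Set.mem_ofPred_eq]
      exact ⟨fun h => ⟨⟨⟨h.1, h.2⟩, h.3⟩, h.4⟩, fun h => ⟨h.1.1.1, h.1.1.2, h.1.2, h.2⟩⟩
    rw [this]
    refine (((isClosed_iInter fun f => isClosed_iInter fun x => isClosed_iInter fun y =>
      isClosed_iInter fun a => isClosed_eq (continuous_finsetSum _ fun σ _ => hcl.1 f x σ)
        (hcl.2 _ _)).inter (isClosed_iInter fun y => isClosed_eq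
          (continuous_finsetSum _ fun a _ => hcl.2 y a) continuous_const)).inter
      (isClosed_iInter fun f => isClosed_iInter fun x => isClosed_iInter fun σ =>
        isClosed_le (hcl.1 f x σ) continuous_const)).inter
      (isClosed_iInter fun y => isClosed_iInter fun a => isClosed_le (hcl.2 y a) continuous_const)
  have hcompact : IsCompact {z : LPCoordinates S X D | (mk z).IsFeasible} := by
    refine (isCompact_Icc (a := (0 : LPCoordinates S X D)) (b := (1 : LPCoordinates S X D))).of_isClosed_subset hclosed ?_
    intro z hz
    exact ⟨⟨fun _ _ _ => zero_le, fun _ _ => zero_le⟩, ⟨hz.3, hz.4⟩⟩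
  have hlsc : LowerSemicontinuous fun z : LPCoordinates S X D => (mk z).objective I A := by
    refine lowerSemicontinuous_sum fun f _ => lowerSemicontinuous_sum fun x _ =>
      lowerSemicontinuous_sum fun σ _ => ?_
    exact (lowerSemicontinuous_const_mul_coe _).comp (hcl.1 f x σ)
  obtain ⟨p, hp⟩ := hne
  obtain ⟨z, hz, hmin⟩ := (hlsc.lowerSemicontinuousOn _).exists_isMinOn
    (s := {z : LPCoordinates S X D | (mk z).IsFeasible}) ⟨(p.lam, p.mu), hp⟩ hcompact
  exact ⟨mk z, hz, fun q hq => hmin (a := (q.lam, q.mu)) hq⟩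

/-- The midpoint of two points of the linear program. -/
noncomputable def LPPoint.mid (p q : LPPoint S X D) : LPPoint S X D where
  lam f x σ := 2⁻¹ * p.lam f x σ + 2⁻¹ * q.lam f x σ
  mu y a := 2⁻¹ * p.mu y a + 2⁻¹ * q.mu y a

theorem two_inv_add_two_inv_nnreal : (2⁻¹ : ℝ≥0) + 2⁻¹ = 1 := by
  rw [← two_mul, mul_inv_cancel₀ two_ne_zero]

theorem LPPoint.IsFeasible.mid {p q : LPPoint S X D} (hp : p.IsFeasible) (hq : q.IsFeasible) :
    (p.mid q).IsFeasible where
  marginal f x y a := by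
    simp only [LPPoint.mid, Finset.sum_add_distrib, ← Finset.mul_sum, hp.marginal, hq.marginal]
  sum_mu y := by
    simp only [LPPoint.mid, Finset.sum_add_distrib, ← Finset.mul_sum, hp.sum_mu, hq.sum_mu,
      mul_one, two_inv_add_two_inv_nnreal]
  lam_le_one f x σ := by
    rw [← two_inv_add_two_inv_nnreal]
    exact add_le_add (mul_le_of_le_one_right' (hp.lam_le_one f x σ))
      (mul_le_of_le_one_right' (hq.lam_le_one f x σ))
  mu_le_one y a := by
    rw [← two_inv_add_two_inv_nnreal]
    exact add_le_add (mul_le_of_le_one_right' (hp.mu_le_one y a))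
      (mul_le_of_le_one_right' (hq.mu_le_one y a))

theorem LPPoint.objective_mid_le {I : Instance S X} {A : GenStructure S D} {p q : LPPoint S X D}
    (h : q.objective I A ≤ p.objective I A) : (p.mid q).objective I A ≤ p.objective I A := by
  have : (p.mid q).objective I A =
      ((2⁻¹ : ℝ≥0) : ℝ≥0∞) * p.objective I A + ((2⁻¹ : ℝ≥0) : ℝ≥0∞) * q.objective I A := by
    simp only [LPPoint.objective, Finset.mul_sum, ← Finset.sum_add_distrib]
    refine Finset.sum_congr rfl fun f _ => Finset.sum_congr rfl fun x _ =>
      Finset.sum_congr rfl fun σ _ => ?_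
    simp only [LPPoint.mid, ENNReal.coe_add, ENNReal.coe_mul]
    ring
  rw [this]
  calc _ ≤ ((2⁻¹ : ℝ≥0) : ℝ≥0∞) * p.objective I A + ((2⁻¹ : ℝ≥0) : ℝ≥0∞) * p.objective I A := by
        gcongr
    _ = p.objective I A := by
        rw [← add_mul, ← ENNReal.coe_add, two_inv_add_two_inv_nnreal, ENNReal.coe_one, one_mul]

/-- The support of a point of the linear program. -/
def LPPoint.support (p : LPPoint S X D) :
    Set ((Σ (f : S.Symbol) (x : Fin (S.arity f) → X), (Set.range x → D)) ⊕ X × D) :=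
  {z | Sum.elim (fun z => p.lam z.1 z.2.1 z.2.2) (fun z => p.mu z.1 z.2) z ≠ 0}

/-- There is a minimiser of the linear program whose support contains the support of every
other minimiser. -/
theorem exists_isMin_max_support (I : Instance S X) (A : GenStructure S D)
    (hne : ∃ p : LPPoint S X D, p.IsFeasible) :
    ∃ p : LPPoint S X D, p.IsFeasible ∧
      (∀ q : LPPoint S X D, q.IsFeasible → p.objective I A ≤ q.objective I A) ∧
      ∀ q : LPPoint S X D, q.IsFeasible → q.objective I A ≤ p.objective I A →
        (∀ f x σ, q.lam f x σ ≠ 0 → p.lam f x σ ≠ 0) ∧ ∀ y a, q.mu y a ≠ 0 → p.mu y a ≠ 0 := by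
  obtain ⟨p₀, hp₀, hmin₀⟩ := exists_isFeasible_isMin I A hne
  let F : Set (Set ((Σ (f : S.Symbol) (x : Fin (S.arity f) → X), (Set.range x → D)) ⊕ X × D)) :=
    LPPoint.support '' {p | p.IsFeasible ∧ p.objective I A ≤ p₀.objective I A}
  obtain ⟨_, ⟨⟨p, ⟨hp, hpo⟩, rfl⟩, hmax⟩⟩ :=
    (Set.toFinite F).exists_maximal ⟨_, p₀, ⟨hp₀, le_rfl⟩, rfl⟩
  refine ⟨p, hp, fun q hq => hpo.trans (hmin₀ q hq), fun q hq hqo => ?_⟩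
  -- The midpoint is again optimal and its support is the union of both supports.
  have hsub := hmax ⟨p.mid q, ⟨hp.mid hq, (LPPoint.objective_mid_le hqo).trans hpo⟩, rfl⟩
    (fun z hz => by
      rcases z with z | z <;>
      · simp only [LPPoint.support, Set.mem_ofPred_eq, Sum.elim_inl, Sum.elim_inr] at hz
        simp [LPPoint.support, LPPoint.mid, hz])
  constructor
  · intro f x σ h
    exact @hsub (.inl ⟨f, x, σ⟩) (by simp [LPPoint.support, LPPoint.mid, h])
  · intro y a h
    exact @hsub (.inr (y, a)) (by simp [LPPoint.support, LPPoint.mid, h])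

end Minimiser

/-! ### Image distributions -/

section Pushforward

variable {α β M N : Type*} [Fintype α] [Fintype β] [DecidableEq β]

/-- The image of a finitely supported distribution under a map. -/
def push [AddCommMonoid M] (φ : α → β) (ω : α → M) (b : β) : M :=
  ∑ a, if φ a = b then ω a else 0

/-- Change of variables for expectations; `ι` lets the weights live in a smaller structure than the
costs. -/
theorem sum_push_mul [AddCommMonoid M] [NonUnitalNonAssocSemiring N] (ι : M →+ N) (φ : α → β)
    (ω : α → M) (c : β → N) : ∑ b, ι (push φ ω b) * c b = ∑ a, ι (ω a) * c (φ a) := by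
  simp only [push, map_sum, Finset.sum_mul]
  rw [Finset.sum_comm]
  refine Finset.sum_congr rfl fun a _ => ?_
  rw [Finset.sum_eq_single (φ a)]
  · simp
  · intro b _ hb
    simp [hb.symm]
  · simp

theorem sum_push [AddCommMonoid M] (φ : α → β) (ω : α → M) : ∑ b, push φ ω b = ∑ a, ω a := by
  simp only [push]
  rw [Finset.sum_comm]
  simp

theorem exists_of_push_ne_zero [AddCommMonoid M] {φ : α → β} {ω : α → M} {b : β}
    (h : push φ ω b ≠ 0) : ∃ a, φ a = b ∧ ω a ≠ 0 := by
  obtain ⟨a, -, ha⟩ := Finset.exists_ne_zero_of_sum_ne_zero h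
  by_cases hb : φ a = b
  · exact ⟨a, hb, by simpa [hb] using ha⟩
  · simp [hb] at ha

end Pushforward

/-- The embedding of the non-negative rationals into the extended ones. -/
def Cost.ofNNRat : ℚ≥0 →+ Cost := ⟨⟨fun q => (q : Cost), rfl⟩, fun _ _ => rfl⟩

/-! ### Fractional homomorphisms: symmetry and duality -/

section FractionalHom

variable {S : Signature.{v}} {D : Type u} [Fintype D] [DecidableEq D]
  {Y : Type w} [Fintype Y] [DecidableEq Y]

/-- Compose each map with the passage from tuples to multisets. The given tuples are one admissible
ordering, so their average cost bounds the minimum defining `P^m(A)`. -/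
theorem hasTotallySymmetric_of_fracHom {A : GenStructure S D} {m : ℕ}
    (h : FracHom (multisetStructure m A) A) : HasTotallySymmetric A m := by
  classical
  obtain ⟨ω, hω⟩ := h
  let ms : (Fin m → D) → Sym D m := fun t => ⟨Multiset.map t Finset.univ.val, by simp⟩
  refine ⟨push (fun g t => g (ms t)) ω, ⟨(sum_push _ _).trans hω.sum_eq_one, fun f a => ?_⟩, ?_⟩
  · refine (sum_push_mul Cost.ofNNRat _ ω _).trans_le
      ((hω.le f fun j => ms fun i => a i j).trans ?_)
    simp only [multisetStructure]
    gcongr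
    refine Finset.inf_le_of_le (b := fun j i => a i j) ?_ le_rfl
    simp [ms]
  · intro g hg π t
    have hg0 : 0 < push (fun g t => g (ms t)) ω g := hg
    obtain ⟨g, rfl, -⟩ := exists_of_push_ne_zero hg0.ne'
    refine congrArg g (Subtype.ext ?_)
    have hms : ∀ t, ((ms t : Sym D m) : Multiset D) = Multiset.map t Finset.univ.val :=
      fun _ => rfl
    refine (hms _).trans (Eq.trans ?_ (hms t).symm)
    rw [← Function.comp_def, ← Multiset.map_map]
    congr 1
    simp

theorem generatesSymmetric_of_hasTotallySymmetric {A : GenStructure S D} {n : ℕ} (hn : 0 < n)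
    (h : HasTotallySymmetric A n) : GeneratesSymmetric A n := by
  obtain ⟨ω, hω, hsym⟩ := h
  obtain ⟨t, -, ht⟩ := Finset.exists_ne_zero_of_sum_ne_zero
    (hω.sum_eq_one.trans_ne one_ne_zero)
  have ht' : t ∈ supp ω := pos_iff_ne_zero.2 ht
  exact ⟨n, hn, ω, hω, t, hsym t ht', fun C _ hC => hC t ht'⟩

variable [Fintype S.Symbol]

/-- The matrix game alternative, with tuples of finite cost in `B` as rows. The dual weights are
strictly positive, so a map sending such a tuple to infinite cost has infinite measure. -/
theorem exists_instance_of_not_fracHom {B : GenStructure S Y} {A : GenStructure S D}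
    (hBA : ¬FracHom B A) : ∃ I : Instance S Y,
      ∀ g : Y → D, measure I B id < measure I A g := by
  classical
  let R := {r : Σ f : S.Symbol, (Fin (S.arity f) → Y) // B.cost r.1 r.2 ≠ ⊤}
  -- Only these maps are played, so all entries of the matrix are finite.
  let G := {g : Y → D // ∀ r : R, A.cost r.1.1 (g ∘ r.1.2) ≠ ⊤}
  let a : R → G → ℚ≥0 := fun r g => (A.cost r.1.1 (g.1 ∘ r.1.2)).untop (g.2 r)
  let b : R → ℚ≥0 := fun r => (B.cost r.1.1 r.1.2).untop r.2
  have ha : ∀ r g, A.cost r.1.1 (g.1 ∘ r.1.2) = (a r g : Cost) := fun r g =>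
    (WithTop.coe_untop _ _).symm
  have hb : ∀ r : R, B.cost r.1.1 r.1.2 = (b r : Cost) := fun r => (WithTop.coe_untop _ _).symm
  rcases exists_mixed_strategy_or fun (r : R) (g : G) => (a r g : ℚ) - b r with
    ⟨ω, hω, hle⟩ | ⟨c, hc, hpos⟩
  · refine absurd ⟨push Subtype.val ω, (sum_push _ _).trans hω, fun f x => ?_⟩ hBA
    refine (sum_push_mul Cost.ofNNRat _ ω _).trans_le ?_
    by_cases hfx : B.cost f x = ⊤
    · simp [hfx]
    · let r : R := ⟨⟨f, x⟩, hfx⟩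
      have h1 : ∑ g, ω g * a r g ≤ b r := by
        have h2 := hle r
        simp only [mul_sub, Finset.sum_sub_distrib, ← Finset.sum_mul] at h2
        have h3 : ∑ g, (ω g : ℚ) = 1 := by exact_mod_cast hω
        rw [h3, one_mul, sub_nonpos] at h2
        exact_mod_cast h2
      calc _ = ∑ g : G, (ω g : Cost) * (a r g : Cost) :=
            Finset.sum_congr rfl fun g _ => by rw [← ha]; rfl
        _ = ((∑ g, ω g * a r g : ℚ≥0) : Cost) := by
            rw [WithTop.coe_sum]
            exact Finset.sum_congr rfl fun g _ => (WithTop.coe_mul _ _).symm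
        _ ≤ (b r : Cost) := WithTop.coe_le_coe.2 h1
        _ = B.cost f x := (hb r).symm
  · let I : Instance S Y := ⟨fun f x => if h : B.cost f x ≠ ⊤ then c ⟨⟨f, x⟩, h⟩ else 0⟩
    have hI : ∀ r : R, I.weight r.1.1 r.1.2 = c r := fun r => dif_pos r.2
    have hsum : ∀ F : (f : S.Symbol) → (Fin (S.arity f) → Y) → Cost,
        ∑ f, ∑ x, (I.weight f x : Cost) * F f x = ∑ r : R, (c r : Cost) * F r.1.1 r.1.2 := by
      intro F
      rw [← Fintype.sum_sigma' fun f x => (I.weight f x : Cost) * F f x,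
        ← Fintype.sum_subtype_add_sum_subtype (fun r : Σ f : S.Symbol, (Fin (S.arity f) → Y) =>
          B.cost r.1 r.2 ≠ ⊤)]
      convert add_zero _
      · refine Finset.sum_eq_zero fun r _ => ?_
        rw [show I.weight r.1.1 r.1.2 = 0 from dif_neg r.2]
        simp
      · exact (hI _).symm
    have hB : measure I B id = ((∑ r, c r * b r : ℚ≥0) : Cost) := by
      rw [WithTop.coe_sum]
      exact (hsum _).trans (Finset.sum_congr rfl fun r _ => by rw [WithTop.coe_mul, ← hb]; rfl)
    refine ⟨I, fun g => ?_⟩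
    by_cases hg : ∀ r : R, A.cost r.1.1 (g ∘ r.1.2) ≠ ⊤
    · have hA : measure I A g = ((∑ r, c r * a r ⟨g, hg⟩ : ℚ≥0) : Cost) := by
        rw [WithTop.coe_sum]
        exact (hsum _).trans (Finset.sum_congr rfl fun r _ => by rw [WithTop.coe_mul, ← ha])
      rw [hA, hB, WithTop.coe_lt_coe]
      have := hpos ⟨g, hg⟩
      simp only [mul_sub, Finset.sum_sub_distrib, sub_pos] at this
      exact_mod_cast this
    · push Not at hg
      obtain ⟨r, hr⟩ := hg
      have hA : measure I A g = ⊤ := by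
        refine (hsum _).trans (WithTop.sum_eq_top.2 ?_)
        refine ⟨r, Finset.mem_univ r, ?_⟩
        rw [hr, WithTop.mul_top]
        exact fun h => hc r (WithTop.coe_eq_zero.1 h)
      rw [hA, hB]
      exact WithTop.coe_lt_top _

end FractionalHom

/-! ### Iterated images and product distributions -/

section Pushforward

theorem push_push {α β γ M : Type*} [Fintype α] [Fintype β] [DecidableEq β] [DecidableEq γ]
    [AddCommMonoid M] (ψ : β → γ) (φ : α → β) (ω : α → M) :
    push ψ (push φ ω) = push (fun a => ψ (φ a)) ω := by
  funext c
  simp only [push, ← Finset.sum_filter]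
  rw [Finset.sum_comm' (t' := Finset.univ.filter fun a => ψ (φ a) = c) (s' := fun a => {φ a})]
  · simp
  · intro b a
    simp only [Finset.mem_filter, Finset.mem_univ, true_and, Finset.mem_singleton]
    constructor
    · rintro ⟨h, rfl⟩
      exact ⟨rfl, h⟩
    · rintro ⟨rfl, h⟩
      exact ⟨h, rfl⟩

theorem push_ne_zero {α β : Type*} [Fintype α] [DecidableEq β] (φ : α → β) {ω : α → ℝ≥0} {a : α}
    (h : ω a ≠ 0) : push φ ω (φ a) ≠ 0 := by
  intro h0
  have := (Finset.sum_eq_zero_iff.1 h0) a (Finset.mem_univ a)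
  simp [h] at this

/-- The marginals of a product distribution. -/
theorem push_eval_prod {T D : Type*} [Fintype T] [DecidableEq T] [Fintype D] [DecidableEq D]
    (F : T → D → ℝ≥0) (hF : ∀ z, ∑ a, F z a = 1) (y : T) :
    push (fun σ : T → D => σ y) (fun σ => ∏ z, F z (σ z)) = F y := by
  funext a
  have h : ∀ σ : T → D, (if σ y = a then ∏ z, F z (σ z) else 0) =
      ∏ z, if z = y then (if σ z = a then F z (σ z) else 0) else F z (σ z) := by
    intro σ
    split_ifs with hσ
    · refine Finset.prod_congr rfl fun z _ => ?_
      split_ifs with h1 h2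
      · rfl
      · exact absurd (h1 ▸ hσ) h2
      · rfl
    · exact (Finset.prod_eq_zero (Finset.mem_univ y) (by simp [hσ])).symm
  simp only [push, h]
  rw [← Fintype.piFinset_univ, ← Finset.prod_univ_sum (fun _ => Finset.univ) fun z b =>
    if z = y then (if b = a then F z b else 0) else F z b]
  rw [Finset.prod_eq_single y]
  · simp
  · intro z _ hz
    simp [hz, hF]
  · simp

theorem push_prod {ι Ω Θ : Type*} [Fintype ι] [DecidableEq ι] [Fintype Ω] [DecidableEq Ω]
    [Fintype Θ] [DecidableEq Θ] (π : Ω → Θ) (l : Ω → ℝ≥0) :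
    push (fun (σ : ι → Ω) i => π (σ i)) (fun σ => ∏ i, l (σ i)) =
      fun b => ∏ i, push π l (b i) := by
  funext b
  simp only [push]
  rw [Finset.prod_univ_sum (fun _ => Finset.univ), Fintype.piFinset_univ]
  refine Finset.sum_congr rfl fun σ _ => ?_
  rw [Finset.prod_ite_zero]
  simp [funext_iff]

end Pushforward

section Feasible

variable {S : Signature.{v}} {D : Type u} [Fintype D] [DecidableEq D]
  {X : Type w} [Fintype X] [DecidableEq X]

theorem LPPoint.IsFeasible.push_lam {p : LPPoint S X D} (hp : p.IsFeasible) (f : S.Symbol)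
    (x : Fin (S.arity f) → X) (y : Set.range x) : push (fun σ => σ y) (p.lam f x) = p.mu y := by
  funext a
  rw [← hp.marginal f x y a, push, Finset.sum_filter]

theorem LPPoint.isFeasible_of_push {p : LPPoint S X D}
    (hmarg : ∀ f x y, push (fun σ => σ y) (p.lam f x) = p.mu y)
    (hsum : ∀ y, ∑ a : D, p.mu y a = 1) : p.IsFeasible := by
  refine LPPoint.isFeasible_of_marginal (fun f x y a => ?_) hsum
  rw [← hmarg f x y, push, Finset.sum_filter]

theorem LPPoint.IsFeasible.sum_lam {p : LPPoint S X D} (hp : p.IsFeasible) (f : S.Symbol)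
    (x : Fin (S.arity f) → X) : ∑ σ, p.lam f x σ = 1 := by
  rw [← hp.sum_mu (x ⟨0, S.arity_pos f⟩), 
    ← sum_push (fun σ => σ ⟨x ⟨0, S.arity_pos f⟩, Set.mem_range_self _⟩), hp.push_lam]

end Feasible

/-! ### Fractional polymorphisms acting on the program -/

section Action

variable {D : Type u} [Fintype D] [DecidableEq D] {k : ℕ}

/-- The coordinatewise action of operations on assignments. -/
def applyOp {T D : Type*} {k : ℕ} (g : Op D k) (σ : Fin k → T → D) : T → D :=
  fun z => g fun i => σ i z

/-- The distribution of `G g (σ₁, …, σₖ)` for independent `σᵢ` distributed according to `l`,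
and `g` distributed according to `ω`. -/
noncomputable def actDist {Ω : Type*} [Fintype Ω] [DecidableEq Ω]
    (G : Op D k → (Fin k → Ω) → Ω) (ω : Op D k → ℚ≥0) (l : Ω → ℝ≥0) : Ω → ℝ≥0 :=
  push (fun z : Op D k × (Fin k → Ω) => G z.1 z.2) fun z => (ω z.1 : ℝ≥0) * ∏ i, l (z.2 i)

variable {Ω Θ : Type*} [Fintype Ω] [DecidableEq Ω] [Fintype Θ] [DecidableEq Θ]

/-- The image of an independent sample is an independent sample. Applied to evaluation at a
variable, this keeps the marginal equations under the action. -/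
theorem push_actDist {G : Op D k → (Fin k → Ω) → Ω} {H : Op D k → (Fin k → Θ) → Θ} {π : Ω → Θ}
    (hπ : ∀ g σ, π (G g σ) = H g fun i => π (σ i)) (ω : Op D k → ℚ≥0) (l : Ω → ℝ≥0) :
    push π (actDist G ω l) = actDist H ω (push π l) := by
  have h : (fun z : Op D k × (Fin k → Θ) => (ω z.1 : ℝ≥0) * ∏ i, push π l (z.2 i)) =
      push (fun z : Op D k × (Fin k → Ω) => (z.1, fun i => π (z.2 i)))
        fun z => (ω z.1 : ℝ≥0) * ∏ i, l (z.2 i) := by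
    funext ⟨g, b⟩
    have := congrFun (push_prod (ι := Fin k) π l) b
    simp only [push] at this ⊢
    rw [← this, Fintype.sum_prod_type, Finset.sum_eq_single g]
    · simp [Finset.mul_sum]
    · intro g' _ hg
      simp [hg]
    · simp
  simp only [actDist, push_push, h, hπ]

theorem sum_actDist (G : Op D k → (Fin k → Ω) → Ω) {ω : Op D k → ℚ≥0} {l : Ω → ℝ≥0}
    (hω : ∑ g, ω g = 1) (hl : ∑ s, l s = 1) : ∑ s, actDist G ω l s = 1 := by
  have h1 : ∑ g, (ω g : ℝ≥0) = 1 := by exact_mod_cast congrArg (NNRat.cast (K := ℝ≥0)) hω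
  rw [actDist, sum_push, Fintype.sum_prod_type]
  simp only [← Finset.mul_sum]
  rw [← Finset.sum_mul, h1, one_mul, ← Fintype.piFinset_univ,
    ← Finset.prod_univ_sum (fun _ => Finset.univ) fun _ s => l s]
  simp [hl]

/-- For fixed samples `σ i`, the expectation over `g` is at most the average of the `c (σ i)`; each
`σ i` has distribution `l`. -/
theorem sum_actDist_mul_le (G : Op D k → (Fin k → Ω) → Ω) {ω : Op D k → ℚ≥0} {l : Ω → ℝ≥0}
    (hk : 0 < k) (hl : ∑ s, l s = 1) (c : Ω → ℝ≥0∞)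
    (hc : ∀ σ, ∑ g, ((ω g : ℝ≥0) : ℝ≥0∞) * c (G g σ) ≤ (k : ℝ≥0∞)⁻¹ * ∑ i, c (σ i)) :
    ∑ s, (actDist G ω l s : ℝ≥0∞) * c s ≤ ∑ s, (l s : ℝ≥0∞) * c s := by
  have hι := sum_push_mul (ENNReal.ofNNRealHom : ℝ≥0 →+ ℝ≥0∞)
    (fun z : Op D k × (Fin k → Ω) => G z.1 z.2) (fun z => (ω z.1 : ℝ≥0) * ∏ i, l (z.2 i)) c
  refine hι.trans_le ?_
  rw [Fintype.sum_prod_type_right]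
  have hmarg : ∀ i, ∑ σ : Fin k → Ω, ((∏ j, l (σ j) : ℝ≥0) : ℝ≥0∞) * c (σ i) =
      ∑ s, (l s : ℝ≥0∞) * c s := by
    intro i
    have h1 := sum_push_mul (ENNReal.ofNNRealHom : ℝ≥0 →+ ℝ≥0∞) (fun σ : Fin k → Ω => σ i)
      (fun σ => ∏ j, l (σ j)) c
    rw [push_eval_prod (fun _ => l) (fun _ => hl) i] at h1
    exact h1.symm
  calc _ = ∑ σ : Fin k → Ω, ((∏ j, l (σ j) : ℝ≥0) : ℝ≥0∞) *
        ∑ g, ((ω g : ℝ≥0) : ℝ≥0∞) * c (G g σ) := by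
        refine Finset.sum_congr rfl fun σ _ => ?_
        rw [Finset.mul_sum]
        refine Finset.sum_congr rfl fun g _ => ?_
        change (((ω g : ℝ≥0) * ∏ i, l (σ i) : ℝ≥0) : ℝ≥0∞) * c (G g σ) = _
        rw [ENNReal.coe_mul]
        ring
    _ ≤ ∑ σ : Fin k → Ω, ((∏ j, l (σ j) : ℝ≥0) : ℝ≥0∞) * ((k : ℝ≥0∞)⁻¹ * ∑ i, c (σ i)) := by
        gcongr with σ
        exact hc σ
    _ = (k : ℝ≥0∞)⁻¹ * ∑ i, ∑ σ : Fin k → Ω, ((∏ j, l (σ j) : ℝ≥0) : ℝ≥0∞) * c (σ i) := by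
        rw [Finset.sum_comm, Finset.mul_sum]
        refine Finset.sum_congr rfl fun σ _ => ?_
        rw [← Finset.mul_sum]
        ring
    _ = ∑ s, (l s : ℝ≥0∞) * c s := by
        simp only [hmarg, Finset.sum_const, Finset.card_univ, Fintype.card_fin, nsmul_eq_mul]
        rw [← mul_assoc, ENNReal.inv_mul_cancel (by simpa using hk.ne') (by simp), one_mul]

theorem actDist_ne_zero (G : Op D k → (Fin k → Ω) → Ω) {ω : Op D k → ℚ≥0} {l : Ω → ℝ≥0}
    {g : Op D k} (hg : g ∈ supp ω) {σ : Fin k → Ω} (hσ : ∀ i, l (σ i) ≠ 0) :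
    actDist G ω l (G g σ) ≠ 0 := by
  have hg' : 0 < ω g := hg
  refine push_ne_zero (fun z : Op D k × (Fin k → Ω) => G z.1 z.2) (a := (g, σ)) ?_
  refine mul_ne_zero ?_ (Finset.prod_ne_zero_iff.2 fun i _ => hσ i)
  exact NNRat.cast_ne_zero.2 hg'.ne'

variable {S : Signature.{v}} {X : Type w} [Fintype X] [DecidableEq X]

/-- The action of a fractional operation on the points of the linear program. -/
noncomputable def LPPoint.act (ω : Op D k → ℚ≥0) (p : LPPoint S X D) : LPPoint S X D where
  lam f x := actDist applyOp ω (p.lam f x)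
  mu y := actDist (fun g b => g b) ω (p.mu y)

theorem LPPoint.IsFeasible.act {p : LPPoint S X D} (hp : p.IsFeasible) {ω : Op D k → ℚ≥0}
    (hω : ∑ g, ω g = 1) : (p.act ω).IsFeasible := by
  refine LPPoint.isFeasible_of_push (fun f x y => ?_) fun y => sum_actDist (fun (g : Op D k) b => g b) hω (hp.sum_mu y)
  have h := push_actDist (G := applyOp)
    (H := fun g b => g b) (π := fun σ => σ y) (fun _ _ => rfl) ω (p.lam f x)
  rw [hp.push_lam] at h
  exact h

variable [Fintype S.Symbol]

theorem LPPoint.objective_act_le {p : LPPoint S X D} (hp : p.IsFeasible) (hk : 0 < k)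
    {ω : Op D k → ℚ≥0} {A : GenStructure S D} (hω : IsFractionalPolymorphism A k ω)
    (I : Instance S X) : (p.act ω).objective I A ≤ p.objective I A := by
  unfold LPPoint.objective
  refine Finset.sum_le_sum fun f _ => Finset.sum_le_sum fun x _ => ?_
  simp only [mul_assoc, ← Finset.mul_sum]
  refine mul_le_mul' le_rfl ?_
  simp only [mul_comm (Cost.toENNReal (A.cost f _))]
  refine sum_actDist_mul_le applyOp hk (hp.sum_lam f x) (fun σ => (A.cost f (applyScope σ)).toENNReal)
    fun σ => ?_
  have h := Cost.toENNReal_le.2 (hω.le f fun i => applyScope (σ i))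
  simp only [Cost.toENNReal_sum, Cost.toENNReal_mul, Cost.toENNReal_coe] at h
  have hk' : (((1 / (k : ℚ≥0) : ℚ≥0) : ℝ≥0) : ℝ≥0∞) = (k : ℝ≥0∞)⁻¹ := by
    rw [NNRat.cast_div, NNRat.cast_one, NNRat.cast_natCast, one_div, ENNReal.coe_inv]
    · simp
    · simpa using hk.ne'
  rw [hk'] at h
  exact h

end Action

/-! ### Integer multiplicities as lists of rows -/

section Rows

theorem exists_push_one_eq {Ω : Type*} [Fintype Ω] [DecidableEq Ω] {N : ℕ} (k : Ω → ℕ)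
    (hk : ∑ s, k s = N) : ∃ R : Fin N → Ω, push R (fun _ => 1) = k := by
  have hcard : Fintype.card (Fin N) = Fintype.card (Σ s, Fin (k s)) := by simp [hk]
  let e : Fin N ≃ Σ s, Fin (k s) := Fintype.equivOfCardEq hcard
  refine ⟨fun i => (e i).1, funext fun s => ?_⟩
  rw [push, e.sum_comp fun z : Σ s, Fin (k s) => if z.1 = s then 1 else 0, Fintype.sum_sigma]
  simp [apply_ite Finset.card]

theorem push_one_apply_ne_zero {α Ω : Type*} [Fintype α] [DecidableEq Ω] (R : α → Ω) (i : α) :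
    push R (fun _ => (1 : ℕ)) (R i) ≠ 0 := by
  intro h
  have := (Finset.sum_eq_zero_iff.1 h) i (Finset.mem_univ i)
  simp at this

/-- Pushing the constant 1 forward counts occurrences; equal counts give bijections of fibres, which
assemble into a permutation. -/
theorem IsSymmetric.eq_of_push_eq {D : Type*} [DecidableEq D] {N : ℕ} {t : Op D N}
    (ht : IsSymmetric t) {b b' : Fin N → D}
    (h : push b (fun _ => (1 : ℕ)) = push b' fun _ => 1) : t b = t b' := by
  have hcard : ∀ a, Nonempty ({i // b i = a} ≃ {i // b' i = a}) := by
    intro a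
    refine Fintype.card_eq.1 ?_
    have := congrFun h a
    simpa [push, Fintype.card_subtype] using this
  let π : Equiv.Perm (Fin N) := Equiv.ofFiberEquiv fun a => (hcard a).some
  rw [← ht π b']
  exact congrArg t (funext fun i => (Equiv.ofFiberEquiv_map _ i).symm)

end Rows

/-! ### The support of a feasible point -/

section Support

variable {S : Signature.{v}} {D : Type u} [Fintype D] [DecidableEq D]
  {X : Type w} [Fintype X] [DecidableEq X]

/-- The operations that preserve the support of a point of the linear program. -/
def LPPoint.supportClone (p : LPPoint S X D) : Set (Σ n : ℕ, Op D n) :=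
  {t | (∀ f x (σ : Fin t.1 → Set.range x → D), (∀ i, p.lam f x (σ i) ≠ 0) →
      p.lam f x (applyOp t.2 σ) ≠ 0) ∧
    ∀ y (b : Fin t.1 → D), (∀ i, p.mu y (b i) ≠ 0) → p.mu y (t.2 b) ≠ 0}

theorem LPPoint.isClone_supportClone (p : LPPoint S X D) : IsClone p.supportClone where
  proj _ i := ⟨fun _ _ _ h => h i, fun _ _ h => h i⟩
  superpose _ _ _ g hh hg := ⟨fun f x σ hσ => hh.1 f x (fun i => applyOp (g i) σ)
      fun i => (hg i).1 f x σ hσ,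
    fun y b hb => hh.2 y (fun i => g i b) fun i => (hg i).2 y b hb⟩

/-- The support of a feasible point contains the rows of a rational feasible point. -/
theorem LPPoint.IsFeasible.exists_rows [Fintype S.Symbol] {p : LPPoint S X D}
    (hp : p.IsFeasible) :
    ∃ N : ℕ, 1 < N ∧ ∃ (R : (f : S.Symbol) → (x : Fin (S.arity f) → X) → Fin N → Set.range x → D)
        (m : X → Fin N → D),
      (∀ f x i, p.lam f x (R f x i) ≠ 0) ∧ (∀ y i, p.mu y (m y i) ≠ 0) ∧
      ∀ (f : S.Symbol) (x : Fin (S.arity f) → X) (z : Set.range x),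
        push (fun i => R f x i z) (fun _ => (1 : ℕ)) = push (m z) fun _ => 1 := by
  obtain ⟨φ, hφ⟩ := exists_linearMap_nat
    (Sum.elim (fun z : Σ (f : S.Symbol) (x : Fin (S.arity f) → X), (Set.range x → D) =>
      (p.lam z.1 z.2.1 z.2.2 : ℝ))
      (Sum.elim (fun z : X × D => (p.mu z.1 z.2 : ℝ)) fun _ : Unit => 1))
    (by rintro (z | z | _) <;> simp)
  choose k hk hk0 using hφ
  -- The factor 2 guarantees `1 < N`, since symmetric operations are only supplied in arities above
  -- 1.
  let kl : ∀ f x, (Set.range x → D) → ℕ := fun f x σ => 2 * k (.inl ⟨f, x, σ⟩)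
  let km : X → D → ℕ := fun y a => 2 * k (.inr (.inl (y, a)))
  let N : ℕ := 2 * k (.inr (.inr ()))
  have h1 : φ 1 = k (.inr (.inr ())) := hk (.inr (.inr ()))
  have hl : ∀ f x σ, φ (p.lam f x σ) = k (.inl ⟨f, x, σ⟩) := fun f x σ => hk (.inl ⟨f, x, σ⟩)
  have hm : ∀ y a, φ (p.mu y a) = k (.inr (.inl (y, a))) := fun y a => hk (.inr (.inl (y, a)))
  have hl0 : ∀ f x σ, kl f x σ ≠ 0 → p.lam f x σ ≠ 0 := by
    intro f x σ h h0
    have := hl f x σ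
    rw [h0, NNReal.coe_zero, map_zero] at this
    exact h (by simpa [kl] using this.symm)
  have hm0 : ∀ y a, km y a ≠ 0 → p.mu y a ≠ 0 := by
    intro y a h h0
    have := hm y a
    rw [h0, NNReal.coe_zero, map_zero] at this
    exact h (by simpa [km] using this.symm)
  have hmsum : ∀ y, ∑ a, km y a = N := by
    intro y
    have := congrArg (fun t : ℝ≥0 => φ t) (hp.sum_mu y)
    simp only [NNReal.coe_sum, map_sum, hm, NNReal.coe_one, h1] at this
    simp only [km, N, ← Finset.mul_sum]
    congr 1
    exact_mod_cast this
  have hmarg : ∀ f x (y : Set.range x), push (fun σ => σ y) (kl f x) = km y := by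
    intro f x y
    funext a
    have := congrArg (fun t : ℝ≥0 => φ t) (hp.marginal f x y a)
    simp only [NNReal.coe_sum, map_sum, hm, hl] at this
    simp only [push, kl, km, ← Finset.sum_filter, ← Finset.mul_sum]
    congr 1
    exact_mod_cast this
  have hlsum : ∀ f x, ∑ σ, kl f x σ = N := by
    intro f x
    rw [← hmsum (x ⟨0, S.arity_pos f⟩),
      ← sum_push (fun σ => σ ⟨x ⟨0, S.arity_pos f⟩, Set.mem_range_self _⟩), hmarg]
  choose R hR using fun f x => exists_push_one_eq (kl f x) (hlsum f x)
  choose m hm' using fun y => exists_push_one_eq (km y) (hmsum y)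
  refine ⟨N, ?_, R, m, fun f x i => hl0 f x _ ?_, fun y i => hm0 y _ ?_, fun f x z => ?_⟩
  · have := hk0 (.inr (.inr ())) one_ne_zero
    omega
  · rw [← hR f x]
    exact push_one_apply_ne_zero _ _
  · rw [← hm' y]
    exact push_one_apply_ne_zero _ _
  · rw [hm' z, ← hmarg f x z, ← hR f x, push_push]

end Support

/-! ### Symmetric operations make the relaxation exact -/

section Solves

variable {S : Signature.{v}} [Fintype S.Symbol] {D : Type u} [Fintype D] [DecidableEq D]

theorem opt_le_blpG_of_generatesSymmetric {X : Type w} [Fintype X] [DecidableEq X]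
    {A : GenStructure S D} (h : ∀ n : ℕ, 1 < n → GeneratesSymmetric A n) (I : Instance S X) :
    Cost.toENNReal (opt I A) ≤ blpG I A := by
  refine le_iInf fun p₀ => le_iInf fun hp₀ => le_iInf fun _ => ?_
  -- The minimum is over all feasible points, ignoring the arc consistent domains; this only lowers
  -- the value.
  obtain ⟨p, hp, hmin, hmax⟩ := exists_isMin_max_support I A ⟨p₀, hp₀⟩
  obtain ⟨N, hN, R, m, hR, hm, hRm⟩ := hp.exists_rows
  obtain ⟨k, hk, ω, hω, t, ht, hgen⟩ := h N hN
  have htC : (⟨N, t⟩ : Σ n : ℕ, Op D n) ∈ p.supportClone := by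
    refine hgen _ p.isClone_supportClone fun g hg => ?_
    have hact := hmax (p.act ω) (hp.act hω.sum_eq_one) (LPPoint.objective_act_le hp hk hω I)
    exact ⟨fun f x σ hσ => hact.1 f x _ (actDist_ne_zero applyOp hg hσ),
      fun y b hb => hact.2 y _ (actDist_ne_zero (fun g b => g b) hg hb)⟩
  let s : X → D := fun y => t (m y)
  -- The column of `z` in every scope has the same multiset as `m z`, so collapsing with `t` gives
  -- values that agree across scopes.
  have hs : ∀ f (x : Fin (S.arity f) → X), applyOp t (R f x) = fun z : Set.range x => s z := by
    intro f x
    funext z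
    exact ht.eq_of_push_eq (hRm f x z)
  calc Cost.toENNReal (opt I A) ≤ Cost.toENNReal (measure I A s) :=
        Cost.toENNReal_le.2 (Finset.inf_le (Finset.mem_univ s))
    _ = (integralPoint S s).objective I A := (objective_integralPoint I A s).symm
    _ ≤ p.objective I A := by
        refine LPPoint.objective_le_of_support hp (integralPoint_isFeasible s) hmin
          (fun f x σ => ?_) fun y a => ?_
        · intro h0
          refine if_neg ?_
          rintro rfl
          refine htC.1 f x (R f x) (hR f x) ?_
          rw [hs, h0]
        · intro h0
          refine if_neg ?_
          rintro rfl
          exact htC.2 y (m y) (hm y) h0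
    _ ≤ p₀.objective I A := hmin p₀ hp₀

theorem blpGSolves_of_generatesSymmetric {A : GenStructure S D}
    (h : ∀ n : ℕ, 1 < n → GeneratesSymmetric A n) : BLPgSolves A := fun _ _ _ I =>
  le_antisymm (blpG_le_opt I A) (opt_le_blpG_of_generatesSymmetric h I)

end Solves

/-- The embedding of the non-negative rationals into `[0, ∞]`. -/
noncomputable def Cost.nnratHom : ℚ≥0 →+ ℝ≥0∞ :=
  ⟨⟨fun q => Cost.toENNReal (q : Cost), Cost.toENNReal_zero⟩, 
    fun a b => Cost.toENNReal_add (a : Cost) (b : Cost)⟩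

/-! ### Instances with copied variables -/

section Copies

variable {S : Signature.{v}} {D : Type u} [Fintype D] [DecidableEq D]
  {Y : Type w} [Fintype Y] [DecidableEq Y] {r K : ℕ}

/-- A scope in which the `j`-th entry `y` is replaced by the copy of `y` with index `s y j`. -/
def copyScope {k : ℕ} (hk : k ≤ r) (s : Y → (Fin r ↪ Fin K)) (y : Fin k → Y) :
    Fin k → Y × Fin K :=
  fun j => (y j, s (y j) (Fin.castLE hk j))

theorem copyScope_injective {k : ℕ} (hk : k ≤ r) (s : Y → (Fin r ↪ Fin K)) (y : Fin k → Y) :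
    Function.Injective (copyScope hk s y) := by
  intro i j hij
  simp only [copyScope, Prod.mk.injEq] at hij
  obtain ⟨h1, h2⟩ := hij
  rw [h1] at h2
  exact Fin.castLE_injective hk ((s (y j)).injective h2)

/-- The instance that has `K` copies of every variable, in which every constraint is imposed on
all scopes consisting of pairwise distinct copies. -/
noncomputable def copies (hr : ∀ f, S.arity f ≤ r) (K : ℕ) (I : Instance S Y) : Instance S (Y × Fin K) where
  weight f := push (fun z : (Fin (S.arity f) → Y) × (Y → (Fin r ↪ Fin K)) =>
    copyScope (hr f) z.2 z.1) fun z => I.weight f z.1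

theorem sum_weight_copies (hr : ∀ f, S.arity f ≤ r) (I : Instance S Y) (f : S.Symbol)
    (F : (Fin (S.arity f) → Y × Fin K) → ℝ≥0∞) :
    ∑ x, Cost.toENNReal ((copies hr K I).weight f x : Cost) * F x =
      ∑ y, Cost.toENNReal (I.weight f y : Cost) * ∑ s, F (copyScope (hr f) s y) := by
  refine (sum_push_mul Cost.nnratHom _ _ F).trans ?_
  simp only [Fintype.sum_prod_type, Finset.mul_sum]
  rfl

/-- A family of joint distributions, one for each constraint, with common marginals `μ`. -/
structure IsCoupling (L : (f : S.Symbol) → (Fin (S.arity f) → Y) → (Fin (S.arity f) → D) → ℝ≥0)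
    (μ : Y → D → ℝ≥0) : Prop where
  marginal : ∀ f y j, push (fun t => t j) (L f y) = μ (y j)
  sum_eq_one : ∀ y, ∑ a, μ y a = 1

open Classical in
/-- The point of the linear program of an instance with copied variables that is defined by a
family of joint distributions. -/
noncomputable def couplingPoint
    (L : (f : S.Symbol) → (Fin (S.arity f) → Y) → (Fin (S.arity f) → D) → ℝ≥0)
    (μ : Y → D → ℝ≥0) (K : ℕ) : LPPoint S (Y × Fin K) D where
  lam f x σ := if Function.Injective x then L f (fun j => (x j).1) (applyScope σ) else
    ∏ z, μ z.1.1 (σ z)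
  mu z := μ z.1

theorem applyScope_bijective {X : Type*} {k : ℕ} {x : Fin k → X} (hx : Function.Injective x) :
    Function.Bijective (applyScope : (Set.range x → D) → Fin k → D) :=
  ((Equiv.ofInjective x hx).arrowCongr (Equiv.refl D)).symm.bijective

variable {L L' : (f : S.Symbol) → (Fin (S.arity f) → Y) → (Fin (S.arity f) → D) → ℝ≥0}
  {μ μ' : Y → D → ℝ≥0}

/-- On injective scopes, assignments are the same as tuples. Other scopes still need a `λ` with the
right marginals; the product distribution provides one. -/
theorem IsCoupling.isFeasible (h : IsCoupling L μ) (K : ℕ) : (couplingPoint L μ K).IsFeasible := by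
  refine LPPoint.isFeasible_of_push (fun f x y => ?_) fun y => h.sum_eq_one y.1
  by_cases hx : Function.Injective x
  · obtain ⟨_, j, rfl⟩ := y
    simp only [couplingPoint, if_pos hx]
    rw [← h.marginal f (fun j => (x j).1) j]
    funext a
    exact (applyScope_bijective hx).sum_comp fun t : Fin (S.arity f) → D =>
      if t j = a then L f (fun j => (x j).1) t else 0
  · simp only [couplingPoint, if_neg hx]
    exact push_eval_prod (fun z : Set.range x => μ z.1.1) (fun z => h.sum_eq_one _) y

theorem couplingPoint_support (hL : ∀ f y t, L f y t = 0 → L' f y t = 0)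
    (hμ : ∀ y a, μ y a = 0 → μ' y a = 0) (K : ℕ) :
    (∀ f x σ, (couplingPoint L μ K).lam f x σ = 0 → (couplingPoint L' μ' K).lam f x σ = 0) ∧
      ∀ y a, (couplingPoint L μ K).mu y a = 0 → (couplingPoint L' μ' K).mu y a = 0 := by
  refine ⟨fun f x σ => ?_, fun y a => hμ y.1 a⟩
  simp only [couplingPoint]
  split_ifs
  · exact hL f _ _
  · simp only [Finset.prod_eq_zero_iff]
    rintro ⟨z, hz, h0⟩
    exact ⟨z, hz, hμ _ _ h0⟩

variable [Fintype S.Symbol]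

/-- Each original constraint occurs once for every choice `s` of copies, always on an injective
scope and with the same expected cost. -/
theorem objective_couplingPoint (hr : ∀ f, S.arity f ≤ r) (I : Instance S Y)
    (A : GenStructure S D) (L) (μ : Y → D → ℝ≥0) :
    (couplingPoint L μ K).objective (copies hr K I) A =
      (Fintype.card (Y → (Fin r ↪ Fin K)) : ℝ≥0∞) * ∑ f, ∑ y,
        Cost.toENNReal (I.weight f y : Cost) *
          ∑ t, (L f y t : ℝ≥0∞) * Cost.toENNReal (A.cost f t) := by
  simp only [LPPoint.objective, mul_assoc, ← Finset.mul_sum, sum_weight_copies]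
  rw [Finset.mul_sum]
  refine Finset.sum_congr rfl fun f _ => ?_
  rw [Finset.mul_sum]
  refine Finset.sum_congr rfl fun y _ => ?_
  rw [mul_left_comm]
  congr 1
  rw [← nsmul_eq_mul, ← Finset.card_univ, ← Finset.sum_const]
  refine Finset.sum_congr rfl fun s _ => ?_
  have hs := copyScope_injective (hr f) s y
  rw [← (applyScope_bijective (D := D) hs).sum_comp]
  refine Finset.sum_congr rfl fun σ _ => ?_
  rw [mul_comm]
  simp only [couplingPoint, if_pos hs]
  rfl

theorem toENNReal_measure (I : Instance S Y) (A : GenStructure S D) (g : Y → D) :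
    Cost.toENNReal (measure I A g) =
      ∑ f, ∑ y, Cost.toENNReal (I.weight f y : Cost) * Cost.toENNReal (A.cost f (g ∘ y)) := by
  simp only [measure, Cost.toENNReal_sum, Cost.toENNReal_mul]

theorem isCoupling_dirac (S : Signature.{v}) (g : Y → D) : IsCoupling (S := S)
    (fun _ y => push (fun _ : Unit => g ∘ y) fun _ => 1)
    fun y => push (fun _ : Unit => g y) fun _ => 1 where
  marginal _ _ _ := push_push _ _ _
  sum_eq_one y := by rw [sum_push]; simp

theorem objective_dirac (hr : ∀ f, S.arity f ≤ r) (I : Instance S Y) (A : GenStructure S D)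
    (g : Y → D) (μ : Y → D → ℝ≥0) :
    (couplingPoint (fun _ y => push (fun _ : Unit => g ∘ y) fun _ => 1) μ K).objective
      (copies hr K I) A =
      (Fintype.card (Y → (Fin r ↪ Fin K)) : ℝ≥0∞) * Cost.toENNReal (measure I A g) := by
  rw [objective_couplingPoint, toENNReal_measure]
  congr 1
  refine Finset.sum_congr rfl fun f _ => Finset.sum_congr rfl fun y _ => ?_
  congr 1
  refine (sum_push_mul (ENNReal.ofNNRealHom : ℝ≥0 →+ ℝ≥0∞) _ _ _).trans ?_
  simp only [Finset.univ_unique, Finset.sum_singleton]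
  exact one_mul _

/-- This is `h` read on uniformly random copies, so the value at a variable does not depend on the
position at which it is read. -/
theorem isCoupling_copies [NeZero r] [Nonempty (Y → (Fin r ↪ Fin K))]
    (hr : ∀ f, S.arity f ≤ r) (h : Y × Fin K → D) : IsCoupling
    (fun f y => push (fun s => h ∘ copyScope (hr f) s y)
      fun _ => (Fintype.card (Y → (Fin r ↪ Fin K)) : ℝ≥0)⁻¹)
    fun y => push (fun s : Y → (Fin r ↪ Fin K) => h (y, s y 0))
      fun _ => (Fintype.card (Y → (Fin r ↪ Fin K)) : ℝ≥0)⁻¹ where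
  marginal f y j := by
    rw [push_push]
    funext a
    -- Exchanging the indices 0 and `j` permutes the choices of copies and carries one marginal to
    -- the other.
    let e : (Y → (Fin r ↪ Fin K)) ≃ (Y → (Fin r ↪ Fin K)) := Equiv.piCongrRight fun _ =>
      Equiv.embeddingCongr (Equiv.swap 0 (Fin.castLE (hr f) j)) (Equiv.refl _)
    rw [push, push, ← e.sum_comp]
    refine Finset.sum_congr rfl fun s _ => ?_
    simp [e, copyScope, Equiv.embeddingCongr]
  sum_eq_one y := by
    rw [sum_push, Finset.sum_const, Finset.card_univ, nsmul_eq_mul, mul_inv_cancel₀]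
    exact_mod_cast Fintype.card_ne_zero

/-- The uniform weight cancels the number of choices, so averaging `h` over copies retains its exact
cost. -/
theorem objective_copies [Nonempty (Y → (Fin r ↪ Fin K))] (hr : ∀ f, S.arity f ≤ r)
    (I : Instance S Y) (A : GenStructure S D) (h : Y × Fin K → D) (μ : Y → D → ℝ≥0) :
    (couplingPoint (fun f y => push (fun s => h ∘ copyScope (hr f) s y)
      fun _ => (Fintype.card (Y → (Fin r ↪ Fin K)) : ℝ≥0)⁻¹) μ K).objective (copies hr K I) A =
      Cost.toENNReal (measure (copies hr K I) A h) := by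
  rw [objective_couplingPoint, toENNReal_measure]
  simp only [sum_weight_copies]
  rw [Finset.mul_sum]
  refine Finset.sum_congr rfl fun f _ => ?_
  rw [Finset.mul_sum]
  refine Finset.sum_congr rfl fun y _ => ?_
  rw [mul_left_comm]
  congr 1
  have := sum_push_mul (ENNReal.ofNNRealHom : ℝ≥0 →+ ℝ≥0∞)
    (fun s => h ∘ copyScope (hr f) s y)
    (fun _ => (Fintype.card (Y → (Fin r ↪ Fin K)) : ℝ≥0)⁻¹) fun t => Cost.toENNReal (A.cost f t)
  refine (congrArg _ this).trans ?_
  rw [← Finset.mul_sum, ← mul_assoc]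
  convert one_mul _
  change _ * (((Fintype.card (Y → (Fin r ↪ Fin K)) : ℝ≥0)⁻¹ : ℝ≥0) : ℝ≥0∞) = 1
  rw [ENNReal.coe_inv (by exact_mod_cast Fintype.card_ne_zero), ENNReal.coe_natCast]
  exact ENNReal.mul_inv_cancel (by exact_mod_cast Fintype.card_ne_zero) (by simp)

end Copies

/-! ### Exactness gives fractional homomorphisms from multisets -/

section Multisets

variable {S : Signature.{v}} {D : Type u} [Fintype D] [DecidableEq D] {m : ℕ}

theorem push_const_eq_count (t : Fin m → D) (c : ℝ≥0) (a : D) :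
    push t (fun _ => c) a = Multiset.count a (Multiset.map t Finset.univ.val) • c := by
  rw [push, ← Finset.sum_filter, Finset.sum_const, Multiset.count_map]
  congr 1
  simp only [Finset.card_def, Finset.filter_val, eq_comm]

theorem exists_map_eq_sym (s : Sym D m) :
    ∃ t : Fin m → D, Multiset.map t Finset.univ.val = (s : Multiset D) := by
  obtain ⟨l, hl⟩ := Quot.exists_rep (s : Multiset D)
  have hlen : l.length = m := by
    rw [← s.2]
    exact congrArg Multiset.card hl
  subst hlen
  refine ⟨l.get, ?_⟩
  rw [Fin.univ_val_map, List.ofFn_get]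
  exact hl

/-- An optimal way to order the multisets in a scope. -/
theorem exists_optimal_order (A : GenStructure S D) (f : S.Symbol)
    (y : Fin (S.arity f) → Sym D m) : ∃ t : Fin (S.arity f) → Fin m → D,
      (∀ j, Multiset.map (t j) Finset.univ.val = (y j : Multiset D)) ∧
      (multisetStructure m A).cost f y =
        ((1 / (m : ℚ≥0) : ℚ≥0) : Cost) * ∑ i : Fin m, A.cost f fun j => t j i := by
  choose t ht using fun j => exists_map_eq_sym (y j)
  obtain ⟨t, ht, hopt⟩ := Finset.exists_mem_eq_inf (Finset.univ.filter
    (fun t : Fin (S.arity f) → Fin m → D =>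
      ∀ j, Multiset.map (t j) Finset.univ.val = (y j : Multiset D))) ⟨t, by simpa using ht⟩
    (fun t => ∑ i : Fin m, A.cost f (fun j => t j i))
  exact ⟨t, (Finset.mem_filter.1 ht).2, congrArg (((1 / (m : ℚ≥0) : ℚ≥0) : Cost) * ·) hopt⟩

variable [Fintype S.Symbol] {r K : ℕ}

/-- Draw a uniformly random index of an optimal ordering. The marginal at each multiset is its
empirical distribution, whatever the scope and the ordering. -/
theorem exists_coupling_multisetStructure (hm : 0 < m) (hr : ∀ f, S.arity f ≤ r)
    (I : Instance S (Sym D m)) (A : GenStructure S D) (K : ℕ) :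
    ∃ p : LPPoint S (Sym D m × Fin K) D, p.IsFeasible ∧
      p.objective (copies hr K I) A = (Fintype.card (Sym D m → (Fin r ↪ Fin K)) : ℝ≥0∞) *
        Cost.toENNReal (measure I (multisetStructure m A) id) := by
  choose t ht hopt using fun f (y : Fin (S.arity f) → Sym D m) => exists_optimal_order A f y
  have hm' : (m : ℝ≥0) ≠ 0 := by exact_mod_cast hm.ne'
  have hc : IsCoupling (S := S) (Y := Sym D m)
      (fun f y => push (fun i j => t f y j i) fun _ : Fin m => (m : ℝ≥0)⁻¹)
      fun y a => Multiset.count a (y : Multiset D) • (m : ℝ≥0)⁻¹ := by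
    constructor
    · intro f y j
      rw [push_push]
      funext a
      rw [← ht f y j]
      exact push_const_eq_count (t f y j) _ a
    · intro y
      obtain ⟨t, ht⟩ := exists_map_eq_sym y
      simp only [← ht, ← push_const_eq_count]
      rw [sum_push]
      simp [hm']
  refine ⟨_, hc.isFeasible K, ?_⟩
  rw [objective_couplingPoint, toENNReal_measure]
  congr 1
  refine Finset.sum_congr rfl fun f _ => Finset.sum_congr rfl fun y _ => ?_
  congr 1
  refine (sum_push_mul (ENNReal.ofNNRealHom : ℝ≥0 →+ ℝ≥0∞) _ _ _).trans ?_
  rw [Function.id_comp, hopt, Cost.toENNReal_mul, Cost.toENNReal_sum, Finset.mul_sum]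
  refine Finset.sum_congr rfl fun i _ => ?_
  congr 1
  rw [Cost.toENNReal_coe, NNRat.cast_div, NNRat.cast_one, NNRat.cast_natCast, one_div]
  rfl

theorem fracHom_of_blpGSolves {A : GenStructure S D} (hA : BLPgSolves A) (hm : 0 < m) :
    FracHom (multisetStructure m A) A := by
  by_contra hnot
  obtain ⟨I, hI⟩ := exists_instance_of_not_fracHom hnot
  -- The added 1 makes `r` positive, so index 0 exists even for an empty signature.
  let r := Finset.univ.sup S.arity + 1
  have hr : ∀ f, S.arity f ≤ r := fun f =>
    (Finset.le_sup (f := S.arity) (Finset.mem_univ f)).trans (Nat.le_succ _)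
  let K := Fintype.card D * r
  have hD : Sym D m → Nonempty D := by
    intro s
    obtain ⟨a, -⟩ := Multiset.card_pos_iff_exists_mem.1 (hm.trans_eq s.2.symm)
    exact ⟨a⟩
  have : Nonempty (Sym D m × Fin K → D) := ⟨fun x => (hD x.1).some⟩
  obtain ⟨h, -, hh⟩ := Finset.exists_mem_eq_inf Finset.univ
    (Finset.univ_nonempty (α := Sym D m × Fin K → D)) (measure (copies hr K I) A)
  -- With `|D| * r` copies, some value is taken on at least `r` of them, enough to fill any scope
  -- with distinct copies.
  have hpop : ∀ y, ∃ a, Nonempty (Fin r ↪ {i : Fin K // h (y, i) = a}) := by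
    intro y
    have := hD y
    obtain ⟨a, ha⟩ := Fintype.exists_le_card_fiber_of_mul_le_card (fun i : Fin K => h (y, i))
      (n := r) (by simp [K])
    refine ⟨a, Function.Embedding.nonempty_of_card_le ?_⟩
    rwa [Fintype.card_fin, Fintype.card_subtype]
  choose g hg using hpop
  let s₀ : Sym D m → (Fin r ↪ Fin K) := fun y =>
    (hg y).some.trans (Function.Embedding.subtype _)
  have hs₀ : ∀ y i, h (y, s₀ y i) = g y := fun y i => ((hg y).some i).2
  have : Nonempty (Sym D m → (Fin r ↪ Fin K)) := ⟨s₀⟩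
  obtain ⟨q, hq, hqobj⟩ := exists_coupling_multisetStructure hm hr I A K
  have hhp := isCoupling_copies hr h
  have hval := objective_copies hr I A h
    fun y => push (fun s : Sym D m → (Fin r ↪ Fin K) => h (y, s y 0))
      fun _ => (Fintype.card (Sym D m → (Fin r ↪ Fin K)) : ℝ≥0)⁻¹
  have hopt : Cost.toENNReal (measure (copies hr K I) A h) = blpG (copies hr K I) A := by
    rw [hA, opt, hh]
  have hcard : (Fintype.card (Sym D m → (Fin r ↪ Fin K)) : ℝ≥0)⁻¹ ≠ 0 :=
    inv_ne_zero (Nat.cast_ne_zero.2 Fintype.card_ne_zero)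
  -- The choice `s₀` of copies on which `h` equals `g` has positive probability, so the Dirac
  -- coupling of `g` lies in the support of the averaged one.
  have hsupp := couplingPoint_support (L' := fun f y => push (fun _ : Unit => g ∘ y) fun _ => 1)
    (μ' := fun y => push (fun _ : Unit => g y) fun _ => 1)
    (L := fun f y => push (fun s => h ∘ copyScope (hr f) s y)
      fun _ => (Fintype.card (Sym D m → (Fin r ↪ Fin K)) : ℝ≥0)⁻¹)
    (μ := fun y => push (fun s : Sym D m → (Fin r ↪ Fin K) => h (y, s y 0))
      fun _ => (Fintype.card (Sym D m → (Fin r ↪ Fin K)) : ℝ≥0)⁻¹)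
    (fun f y t h0 => by
      by_contra hne
      obtain ⟨_, rfl, -⟩ := exists_of_push_ne_zero hne
      have : h ∘ copyScope (hr f) s₀ y = g ∘ y := funext fun j => hs₀ _ _
      rw [← this] at h0
      exact push_ne_zero (fun s => h ∘ copyScope (hr f) s y) (a := s₀) hcard h0)
    (fun y a h0 => by
      by_contra hne
      obtain ⟨_, rfl, -⟩ := exists_of_push_ne_zero hne
      rw [← hs₀ y 0] at h0
      exact push_ne_zero (fun s : Sym D m → (Fin r ↪ Fin K) => h (y, s y 0)) (a := s₀) hcard h0) K
  -- Exactness of the relaxation makes the averaged point LP-optimal, and its optimality passes to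
  -- `g`.
  have hle := LPPoint.objective_le_of_support (I := copies hr K I) (A := A) (hhp.isFeasible K)
    ((isCoupling_dirac S g).isFeasible K)
    (fun q hq => by rw [hval, hopt]; exact blpG_le_objective _ A hq) hsupp.1 hsupp.2
  rw [objective_dirac, hval, hopt] at hle
  have h1 := (hle.trans (blpG_le_objective _ A hq)).trans_eq hqobj
  rw [ENNReal.mul_le_mul_iff_right (Nat.cast_ne_zero.2 Fintype.card_ne_zero)
    (ENNReal.natCast_ne_top _), Cost.toENNReal_le] at h1
  exact (hI g).not_ge h1

end Multisets

end VCSP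

theorem mainTheorem3 {S : VCSP.Signature.{v}} [Fintype S.Symbol]
    {D : Type u} [Fintype D] [DecidableEq D] (A : VCSP.GenStructure S D) :
    List.TFAE [
      VCSP.BLPgSolves A,
      ∀ m : ℕ, 1 < m → VCSP.FracHom (VCSP.multisetStructure m A) A,
      ∀ m : ℕ, 1 < m → VCSP.HasTotallySymmetric A m,
      ∀ n : ℕ, 1 < n → VCSP.GeneratesSymmetric A n] := by
  tfae_have 1 → 2 := fun h m hm => VCSP.fracHom_of_blpGSolves h (zero_lt_one.trans hm)
  tfae_have 2 → 3 := fun h m hm => VCSP.hasTotallySymmetric_of_fracHom (h m hm)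
  tfae_have 3 → 4 := fun h n hn =>
    VCSP.generatesSymmetric_of_hasTotallySymmetric (zero_lt_one.trans hn) (h n hn)
  tfae_have 4 → 1 := VCSP.blpGSolves_of_generatesSymmetric
  tfae_finish
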